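/- For $\nu\in\mathbb C$ and $b>0$ let $K_\nu(b)=\int_0^\infty e^{-b\cosh u}\cosh(\nu u)\,du$ be the modified Bessel function of the third kind. Let $a>0$. Write $(q)_k=q(q+1)\cdots(q+k-1)$ and let ${}_2F_1$ be the Gauss hypergeometric function. Then $K_{ix}(b)$ is real for all real $x$ and all $b>0$, and the following hold. (1) For all real $x,y$, with $z=x+iy$, $$|K_{iz}(a)|^2=[K_{ix}(a)]^2+y^2\int_0^1 t^{y-1}\,{}_2F_1(y+1,y+1;2;1-t)\,\bigl[K_{ix}(a/\sqrt t)\bigr]^2\,dt ,$$ where the integral converges and its integrand is nonnegative on $(0,1)$. (2) For all real $x,y$ and every $c<-|y|$, $$|K_{iz}(a)|^2=[K_{ix}(a)]^2+y^2L_a(x,y),$$ where $$L_a(x,y)=\frac{\sqrt\pi}{4\pi i}\sum_{k=0}^\infty\frac{((y+1)_k)^2}{(k+1)!}\int_{c-i\infty}^{c+i\infty}\frac{\Gamma(ix-s)\Gamma(-ix-s)\Gamma(y-s)\Gamma(-s)}{\Gamma(\frac12-s)\Gamma(y+k+1-s)}\,a^{2s}\,ds$$ (each contour integral, along the upward vertical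 line $\operatorname{Re}s=c$, converges absolutely, and so does the series), and $$L_a(x,y)=\sum_{k=0}^\infty\frac{((y+1)_k)^2}{k!\,(k+1)!}\int_0^1t^{y-1}(1-t)^k\bigl[K_{ix}(a/\sqrt t)\bigr]^2\,dt>0,$$ where each integral converges, has a nonnegative integrand, and is strictly positive. (3) $K_{iz}(a)$ is an entire function of $z$, and all its zeros are real. -/

import Mathlib

open Complex MeasureTheory Set

noncomputable section

/-- The modified Bessel function of the third kind (Macdonald function)
`K_ν(b) = ∫_0^∞ e^{-b cosh u} cosh (ν u) du`, for complex order `ν` and real argument `b > 0`. -/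
def macdonaldK (ν : ℂ) (b : ℝ) : ℂ :=
  ∫ u in Ioi (0 : ℝ), (Real.exp (-b * Real.cosh u) : ℂ) * Complex.cosh (ν * u)

/-- The number `K_{ix}(b)` for real `x`, as a real number (its imaginary part vanishes). -/
def macdonaldKix (x b : ℝ) : ℝ :=
  (macdonaldK (I * x) b).re

/-- The integrand `t^{y-1} ₂F₁(y+1, y+1; 2; 1-t) [K_{ix}(a/√t)]^2` on `0 < t < 1`. -/
def hyperIntegrand (a x y t : ℝ) : ℝ :=
  t ^ (y - 1) * ₂F₁ (y + 1) (y + 1) (2 : ℝ) (1 - t) * macdonaldKix x (a / √t) ^ 2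

/-- The integrand `t^{y-1} (1-t)^k [K_{ix}(a/√t)]^2` on `0 < t < 1`. -/
def betaIntegrand (a x y : ℝ) (k : ℕ) (t : ℝ) : ℝ :=
  t ^ (y - 1) * (1 - t) ^ k * macdonaldKix x (a / √t) ^ 2

/-- The Mellin-Barnes integrand
`Γ(ix-s) Γ(-ix-s) Γ(y-s) Γ(-s) / (Γ(1/2-s) Γ(y+k+1-s)) * a^{2s}`. -/
def barnesIntegrand (a x y : ℝ) (k : ℕ) (s : ℂ) : ℂ :=
  Gamma (I * x - s) * Gamma (-(I * x) - s) * Gamma (y - s) * Gamma (-s)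
    / (Gamma (1 / 2 - s) * Gamma (y + k + 1 - s)) * (a : ℂ) ^ (2 * s)

/-- The contour integral `∫_{c-i∞}^{c+i∞} f(s) ds` along the upward vertical line `Re s = c`. -/
def verticalIntegral (c : ℝ) (f : ℂ → ℂ) : ℂ :=
  I * ∫ τ : ℝ, f (c + τ * I)

/-- The `k`-th term of the series defining `L_a(x,y)`:
`(√π / (4πi)) ((y+1)_k)^2 / (k+1)!` times the contour integral over `Re s = c`. -/
def barnesTerm (a x y c : ℝ) (k : ℕ) : ℂ :=
  ((√Real.pi : ℝ) : ℂ) / (4 * Real.pi * I)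
    * ((((ascPochhammer ℝ k).eval (y + 1)) ^ 2 / ((k + 1).factorial : ℝ) : ℝ) : ℂ)
    * verticalIntegral c (barnesIntegrand a x y k)

/-- `L_a(x,y)`, computed along the line `Re s = c` (where `c < -|y|`). -/
def barnesL (a x y c : ℝ) : ℂ :=
  ∑' k : ℕ, barnesTerm a x y c k

end

/-! Since $iz=-(y-ix)$ and $K$ is even in its order, $|K_{iz}(b)|^2=K_{y+ix}(b)K_{y-ix}(b)$. Passing
to half-sums and half-differences in the double integral for this product separates the variables
once the Mellin transform in $b$ is taken, and leaves two beta integrals (`mellin_macdonaldK_mul`).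
Up to a constant the transform at $2p$ is $\Gamma(p\pm ix)\Gamma(p\pm
y)/(\Gamma(p)\Gamma(p+\frac12))$, and Mellin inversion gives a Mellin–Barnes integral
(`macdonaldK_mul_eq_mellinBarnes`).

Relative to the case $y=0$, the integrand carries the extra factor
$\Gamma(p+y)\Gamma(p-y)/\Gamma(p)^2$. By Gauss's theorem (`one_add_tsum_gaussTerm`) this is
${}_2F_1(y,y;p+y;1)=1+y^2\sum_k ((y+1)_k)^2/((k+1)!\,(p+y)_{k+1})$. The $1$ gives $K_{ix}(a)^2$ and
the sum gives $L_a(x,y)$ (`summable_barnesTerm_and_mul_tsum`).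

Finally $k!/(p+y)_{k+1}=\int_0^1t^{p+y-1}(1-t)^k\,dt$ and $a^{-2p}t^p=(a/\sqrt t)^{-2p}$, so each
term is a positive multiple or zero multiple of $\int_0^1t^{y-1}(1-t)^kK_{ix}(a/\sqrt t)^2\,dt$.
Summing under the integral produces the hypergeometric kernel. Since $L_a>0$, a zero of $K_{iz}(a)$
forces $y=0$. -/

/-! ### Decay of the defining integrand -/

theorem Real.sq_div_four_le_cosh (u : ℝ) : u ^ 2 / 4 ≤ Real.cosh u := by
  have h := Real.quadratic_le_exp_of_nonneg (abs_nonneg u)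
  have h2 := Real.exp_pos (-|u|)
  have h3 := abs_nonneg u
  rw [← Real.cosh_abs, Real.cosh_eq]
  rw [sq_abs] at h
  linarith

theorem integrable_exp_quadratic {b : ℝ} (hb : 0 < b) (κ : ℝ) :
    Integrable (fun u : ℝ => Real.exp (-b * u ^ 2 + κ * u)) := by
  have h := (integrable_cexp_quadratic (b := (b : ℂ)) (by simpa using hb) (κ : ℂ) 0).norm
  refine h.congr (Filter.Eventually.of_forall fun u => ?_)
  simp only [Complex.norm_exp, add_zero]
  norm_cast

/-- The Gaussian decay coming from `Real.sq_div_four_le_cosh` absorbs any exponential. This is the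
common majorant for integrability, continuity and differentiation under the integral. -/
theorem integrable_exp_neg_cosh_mul_exp {b : ℝ} (hb : 0 < b) (κ : ℝ) :
    Integrable (fun u : ℝ => Real.exp (-b * Real.cosh u) * Real.exp (κ * |u|)) := by
  have h := (integrable_exp_quadratic (b := b / 4) (by positivity) κ).add
    (integrable_exp_quadratic (b := b / 4) (by positivity) (-κ))
  refine h.mono' (by fun_prop) (Filter.Eventually.of_forall fun u => ?_)
  rw [← Real.exp_add, Real.norm_of_nonneg (Real.exp_pos _).le, Pi.add_apply]
  have hc := Real.sq_div_four_le_cosh u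
  have hbc := mul_le_mul_of_nonneg_left hc hb.le
  rcases abs_cases u with ⟨h1, -⟩ | ⟨h1, -⟩ <;> rw [h1]
  · exact (Real.exp_le_exp.mpr (by linarith)).trans
      (le_add_of_nonneg_right (Real.exp_pos _).le)
  · exact (Real.exp_le_exp.mpr (by linarith)).trans
      (le_add_of_nonneg_left (Real.exp_pos _).le)

theorem Complex.norm_exp_mul_ofReal_le (ν : ℂ) (u : ℝ) :
    ‖Complex.exp (ν * u)‖ ≤ Real.exp (‖ν‖ * |u|) := by
  refine (Complex.norm_exp_le_exp_norm _).trans (Real.exp_le_exp.mpr ?_)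
  simp

theorem Complex.norm_cosh_mul_ofReal_le (ν : ℂ) (u : ℝ) :
    ‖Complex.cosh (ν * u)‖ ≤ Real.exp (‖ν‖ * |u|) := by
  have h1 := norm_exp_mul_ofReal_le ν u
  have h2 := norm_exp_mul_ofReal_le (-ν) u
  rw [norm_neg, neg_mul] at h2
  rw [Complex.cosh, norm_div, Complex.norm_ofNat]
  have := norm_add_le (Complex.exp (ν * u)) (Complex.exp (-(ν * u)))
  linarith

theorem Complex.norm_sinh_mul_ofReal_le (ν : ℂ) (u : ℝ) :
    ‖Complex.sinh (ν * u)‖ ≤ Real.exp (‖ν‖ * |u|) := by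
  have h1 := norm_exp_mul_ofReal_le ν u
  have h2 := norm_exp_mul_ofReal_le (-ν) u
  rw [norm_neg, neg_mul] at h2
  rw [Complex.sinh, norm_div, Complex.norm_ofNat]
  have := norm_sub_le (Complex.exp (ν * u)) (Complex.exp (-(ν * u)))
  linarith

theorem integrable_exp_neg_cosh_mul_cexp {b : ℝ} (hb : 0 < b) (ν : ℂ) :
    Integrable (fun u : ℝ => (Real.exp (-b * Real.cosh u) : ℂ) * Complex.exp (ν * u)) := by
  refine (integrable_exp_neg_cosh_mul_exp hb ‖ν‖).mono' (by fun_prop)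
    (Filter.Eventually.of_forall fun u => ?_)
  rw [norm_mul, Complex.norm_real, Real.norm_of_nonneg (Real.exp_pos _).le]
  exact mul_le_mul_of_nonneg_left (Complex.norm_exp_mul_ofReal_le ν u) (Real.exp_pos _).le

theorem integrable_exp_neg_cosh_mul_ccosh {b : ℝ} (hb : 0 < b) (ν : ℂ) :
    Integrable (fun u : ℝ => (Real.exp (-b * Real.cosh u) : ℂ) * Complex.cosh (ν * u)) := by
  refine (integrable_exp_neg_cosh_mul_exp hb ‖ν‖).mono' (by fun_prop)
    (Filter.Eventually.of_forall fun u => ?_)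
  rw [norm_mul, Complex.norm_real, Real.norm_of_nonneg (Real.exp_pos _).le]
  exact mul_le_mul_of_nonneg_left (Complex.norm_cosh_mul_ofReal_le ν u) (Real.exp_pos _).le

/-! ### Symmetries and regularity of the Macdonald function -/

/-- The Macdonald function as an integral over the whole line. -/
theorem macdonaldK_eq_integral {b : ℝ} (hb : 0 < b) (ν : ℂ) :
    macdonaldK ν b
      = 1 / 2 * ∫ u : ℝ, (Real.exp (-b * Real.cosh u) : ℂ) * Complex.exp (ν * u) := by
  have hi := integrable_exp_neg_cosh_mul_cexp hb ν
  have hn : ∫ u in Iic (0 : ℝ), (Real.exp (-b * Real.cosh u) : ℂ) * Complex.exp (ν * u)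
      = ∫ u in Ioi (0 : ℝ), (Real.exp (-b * Real.cosh u) : ℂ) * Complex.exp (-ν * u) := by
    have := integral_comp_neg_Iic 0
      (fun u : ℝ => (Real.exp (-b * Real.cosh u) : ℂ) * Complex.exp (-ν * u))
    rw [neg_zero] at this
    rw [← this]
    refine setIntegral_congr_fun measurableSet_Iic fun u _ => ?_
    simp
  rw [← intervalIntegral.integral_Iic_add_Ioi (b := 0) hi.integrableOn hi.integrableOn, hn,
    ← integral_add (integrable_exp_neg_cosh_mul_cexp hb (-ν)).integrableOn hi.integrableOn,
    ← integral_const_mul, macdonaldK]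
  refine integral_congr_ae (Filter.Eventually.of_forall fun u => ?_)
  simp only [Complex.cosh, neg_mul]
  ring

theorem macdonaldK_conj (ν : ℂ) (b : ℝ) :
    (starRingEnd ℂ) (macdonaldK ν b) = macdonaldK ((starRingEnd ℂ) ν) b := by
  rw [macdonaldK, macdonaldK, ← integral_conj]
  refine integral_congr_ae (Filter.Eventually.of_forall fun u => ?_)
  simp only [map_mul, Complex.conj_ofReal, ← Complex.cosh_conj]

theorem macdonaldK_neg (ν : ℂ) (b : ℝ) : macdonaldK (-ν) b = macdonaldK ν b := by
  simp [macdonaldK]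

theorem macdonaldK_I_mul_ofReal (x b : ℝ) : macdonaldK (I * x) b = (macdonaldKix x b : ℂ) := by
  refine (Complex.conj_eq_iff_re.mp ?_).symm
  rw [macdonaldK_conj, map_mul, Complex.conj_I, Complex.conj_ofReal, neg_mul, macdonaldK_neg]

/-- The squared modulus is a product of two Macdonald functions of conjugate orders. -/
theorem norm_macdonaldK_sq (x y b : ℝ) :
    ((‖macdonaldK (I * (x + y * I)) b‖ ^ 2 : ℝ) : ℂ)
      = macdonaldK (y + I * x) b * macdonaldK (y - I * x) b := by
  have h1 : I * (x + y * I) = -(y - I * x) := by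
    linear_combination (y : ℂ) * I_sq
  have h2 : (starRingEnd ℂ) (y - I * x : ℂ) = y + I * x := by simp
  rw [h1, macdonaldK_neg, ← h2, ← macdonaldK_conj, mul_comm ((starRingEnd ℂ) _), Complex.mul_conj,
    Complex.normSq_eq_norm_sq]

/-- Needed because Mellin inversion recovers a function at its points of continuity. The majorant
with $b/2$ serves every argument above $b/2$. -/
theorem continuousAt_macdonaldK (ν : ℂ) {b : ℝ} (hb : 0 < b) :
    ContinuousAt (macdonaldK ν) b := by
  refine continuousAt_of_dominated
    (bound := fun u => Real.exp (-(b / 2) * Real.cosh u) * Real.exp (‖ν‖ * |u|))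
    (Filter.Eventually.of_forall fun c => by fun_prop) ?_
    (integrable_exp_neg_cosh_mul_exp (half_pos hb) _).integrableOn
    (Filter.Eventually.of_forall fun u => by fun_prop)
  filter_upwards [lt_mem_nhds (half_lt_self hb)] with c hc
  refine Filter.Eventually.of_forall fun u => ?_
  rw [norm_mul, Complex.norm_real, Real.norm_of_nonneg (Real.exp_pos _).le]
  refine mul_le_mul ?_ (Complex.norm_cosh_mul_ofReal_le ν u) (norm_nonneg _) (Real.exp_pos _).le
  have := mul_le_mul_of_nonneg_right hc.le (Real.cosh_pos u).le
  exact Real.exp_le_exp.mpr (by linarith)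

theorem differentiable_macdonaldK {b : ℝ} (hb : 0 < b) :
    Differentiable ℂ (fun ν : ℂ => macdonaldK ν b) := by
  intro ν
  have key := hasDerivAt_integral_of_dominated_loc_of_deriv_le
    (μ := volume.restrict (Ioi (0 : ℝ))) (𝕜 := ℂ) (x₀ := ν) (s := Metric.ball ν 1)
    (F := fun ν u => (Real.exp (-b * Real.cosh u) : ℂ) * Complex.cosh (ν * u))
    (F' := fun ν u => (Real.exp (-b * Real.cosh u) : ℂ) * (Complex.sinh (ν * u) * u))
    -- In $\|\nu\|+2$, one unit is the radius of the ball and the other pays for $|u|\le e^{|u|}$.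
    (bound := fun u => Real.exp (-b * Real.cosh u) * Real.exp ((‖ν‖ + 2) * |u|))
    (Metric.ball_mem_nhds ν one_pos)
    (Filter.Eventually.of_forall fun c => by fun_prop)
    (integrable_exp_neg_cosh_mul_ccosh hb ν).integrableOn
    (by fun_prop) ?_ (integrable_exp_neg_cosh_mul_exp hb _).integrableOn ?_
  · exact key.2.differentiableAt
  · refine Filter.Eventually.of_forall fun u c hc => ?_
    rw [norm_mul, Complex.norm_real, Real.norm_of_nonneg (Real.exp_pos _).le]
    refine mul_le_mul_of_nonneg_left ?_ (Real.exp_pos _).le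
    rw [norm_mul, Complex.norm_real, Real.norm_eq_abs]
    have hc' : ‖c‖ ≤ ‖ν‖ + 1 := by
      have := norm_sub_norm_le c ν
      rw [Metric.mem_ball, dist_eq_norm] at hc
      linarith
    calc _ ≤ Real.exp (‖c‖ * |u|) * Real.exp |u| :=
          mul_le_mul (Complex.norm_sinh_mul_ofReal_le c u)
            ((le_add_of_nonneg_right zero_le_one).trans (Real.add_one_le_exp _)) (abs_nonneg _)
            (Real.exp_pos _).le
      _ ≤ _ := by
          rw [← Real.exp_add]
          have := mul_le_mul_of_nonneg_right hc' (abs_nonneg u)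
          exact Real.exp_le_exp.mpr (by linarith)
  · refine Filter.Eventually.of_forall fun u c _ => ?_
    have h := ((hasDerivAt_id c).mul_const (u : ℂ)).ccosh
    simpa using h.const_mul (Real.exp (-b * Real.cosh u) : ℂ)

/-! ### Gauss's summation theorem for ${}_2F_1(y,y;c;1)$ -/

open Filter Topology in
-- A nonzero limit would make the harmonic series comparable to $f$. It removes the boundary term
-- when the contiguous relation is summed.
theorem tendsto_zero_of_summable_of_tendsto_mul {f : ℕ → ℝ} (hf : Summable f) {l : ℝ}
    (hl : Tendsto (fun n : ℕ => ((n : ℝ) + 1) * f n) atTop (𝓝 l)) : l = 0 := by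
  by_contra h
  have hO : (fun n : ℕ => 1 / ((n : ℝ) + 1)) =O[atTop] f := by
    have h1 : ∀ᶠ n : ℕ in atTop, |l| / 2 < |((n : ℝ) + 1) * f n| :=
      hl.abs.eventually (lt_mem_nhds (half_lt_self (abs_pos.mpr h)))
    refine Asymptotics.IsBigO.of_bound (2 / |l|) ?_
    filter_upwards [h1] with n hn
    have hn1 : (0 : ℝ) < n + 1 := by positivity
    have hl0 := abs_pos.mpr h
    rw [abs_mul, abs_of_pos hn1] at hn
    rw [Real.norm_eq_abs, Real.norm_eq_abs, abs_of_pos (by positivity), div_le_iff₀ hn1,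
      div_mul_eq_mul_div, div_mul_eq_mul_div, le_div_iff₀ hl0]
    linarith
  have h2 : Summable (fun n : ℕ => 1 / ((n : ℝ) + 1)) := summable_of_isBigO_nat hf hO
  have h3 := (summable_nat_add_iff (f := fun n : ℕ => 1 / (n : ℝ)) 1).mp (by simpa using h2)
  exact Real.not_summable_one_div_natCast h3

/-- The terms `((y+1)_k)² / ((k+1)! (c)_{k+1})` of the Gauss series, shifted by one. -/
noncomputable def gaussTerm (y : ℝ) (c : ℂ) (k : ℕ) : ℂ :=
  (((ascPochhammer ℝ k).eval (y + 1) : ℝ) : ℂ) ^ 2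
    / ((k + 1).factorial * (ascPochhammer ℂ (k + 1)).eval c)

/-- The real version of `gaussTerm`. -/
noncomputable def gaussTermReal (y c : ℝ) (k : ℕ) : ℝ :=
  (ascPochhammer ℝ k).eval (y + 1) ^ 2 / ((k + 1).factorial * (ascPochhammer ℝ (k + 1)).eval c)

theorem ascPochhammer_eval_ne_zero_of_re_pos {c : ℂ} (hc : 0 < c.re) (k : ℕ) :
    (ascPochhammer ℂ k).eval c ≠ 0 := by
  rw [← Gamma_add_nat_div_Gamma_eq]
  · refine div_ne_zero (Gamma_ne_zero_of_re_pos ?_) (Gamma_ne_zero_of_re_pos hc)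
    simp only [add_re, natCast_re]
    positivity
  · intro m hm
    rw [hm] at hc
    simp only [neg_re, natCast_re] at hc
    have : (0 : ℝ) ≤ m := m.cast_nonneg
    linarith

theorem ascPochhammer_eval_le_norm {c : ℂ} {r : ℝ} (hr : 0 < r) (hc : r ≤ c.re) (k : ℕ) :
    (ascPochhammer ℝ k).eval r ≤ ‖(ascPochhammer ℂ k).eval c‖ := by
  induction k with
  | zero => simp
  | succ k ih =>
    rw [ascPochhammer_succ_eval, ascPochhammer_succ_eval, norm_mul]
    refine mul_le_mul ih ?_ (by positivity) (norm_nonneg _)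
    refine le_trans ?_ (Complex.re_le_norm _)
    simpa using hc

theorem gaussTermReal_nonneg (y : ℝ) {c : ℝ} (hc : 0 < c) (k : ℕ) : 0 ≤ gaussTermReal y c k := by
  have := ascPochhammer_pos (k + 1) c hc
  unfold gaussTermReal
  positivity

/-- Uniform in the half-plane $\operatorname{Re}c\ge r$, hence along the whole sequence $c+n$. -/
theorem norm_gaussTerm_le (y : ℝ) {c : ℂ} {r : ℝ} (hr : 0 < r) (hc : r ≤ c.re) (k : ℕ) :
    ‖gaussTerm y c k‖ ≤ gaussTermReal y r k := by
  have h1 := ascPochhammer_eval_le_norm hr hc (k + 1)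
  have h2 := ascPochhammer_pos (k + 1) r hr
  rw [gaussTerm, gaussTermReal, norm_div, norm_mul, norm_pow, Complex.norm_real,
    Real.norm_eq_abs, sq_abs, Complex.norm_natCast]
  gcongr

/-- The quantity of Raabe's test: the last factor tends to $c-2y$, so the series converges when
$c>2y$. -/
theorem gaussTermReal_telescope (y : ℝ) {c : ℝ} (hc : 0 < c) (k : ℕ) :
    ((k : ℝ) + 1) * gaussTermReal y c k - ((k : ℝ) + 2) * gaussTermReal y c (k + 1)
      = gaussTermReal y c k * (((k + 1) * (c - 2 * y) - y ^ 2) / (c + (k + 1))) := by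
  have h2 := (ascPochhammer_pos (k + 1) c hc).ne'
  have h3 : c + ((k : ℝ) + 1) ≠ 0 := by positivity
  have h4 : ((k + 1).factorial : ℝ) ≠ 0 := by positivity
  simp only [gaussTermReal]
  rw [ascPochhammer_succ_eval (k + 1) c, ascPochhammer_succ_eval k (y + 1),
    Nat.factorial_succ (k + 1)]
  push_cast
  field_simp
  ring

/-- The contiguous relation holds term by term up to an exact difference of $c(k+1)$ times the
$k$-th term. -/
theorem gaussTerm_telescope (y : ℝ) {c : ℂ} (hc : 0 < c.re) (k : ℕ) :
    c * (c - 2 * y) * gaussTerm y c k - (c - y) ^ 2 * gaussTerm y (c + 1) k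
      = c * (((k : ℂ) + 1) * gaussTerm y c k) - c * (((k : ℂ) + 2) * gaussTerm y c (k + 1)) := by
  have h2 := ascPochhammer_eval_ne_zero_of_re_pos hc (k + 1)
  have h3 : c + ((k : ℂ) + 1) ≠ 0 := by
    intro h
    have := congrArg re h
    simp only [add_re, natCast_re, one_re, zero_re] at this
    have : (0 : ℝ) ≤ k := k.cast_nonneg
    linarith
  have h4 : ((k + 1).factorial : ℂ) ≠ 0 := Nat.cast_ne_zero.mpr (Nat.factorial_ne_zero _)
  have h5 : c ≠ 0 := by rintro rfl; simp at hc
  have h6 : c * (ascPochhammer ℂ (k + 1)).eval (c + 1)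
      = (ascPochhammer ℂ (k + 1)).eval c * (c + (k + 1)) := by
    have := ascPochhammer_succ_eval (k + 1) c
    rw [ascPochhammer_succ_left, Polynomial.eval_mul, Polynomial.eval_comp] at this
    simpa using this
  have h7 : (ascPochhammer ℂ (k + 1)).eval (c + 1)
      = (ascPochhammer ℂ (k + 1)).eval c * (c + (k + 1)) / c := by
    rw [← h6]; field_simp
  have h8 : ((k : ℂ) + 1 + 1) ≠ 0 := by exact_mod_cast Nat.succ_ne_zero (k + 1)
  simp only [gaussTerm]
  rw [h7, ascPochhammer_succ_eval (k + 1) c, ascPochhammer_succ_eval k (y + 1),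
    Nat.factorial_succ (k + 1)]
  push_cast
  field_simp
  ring

theorem mul_gaussTermReal_eventually_antitone (y : ℝ) {c : ℝ} (hc : 0 < c) (hcy : 2 * y < c) :
    ∃ N : ℕ, ∀ k ≥ N, (c - 2 * y) / 2 * gaussTermReal y c k
      ≤ ((k : ℝ) + 1) * gaussTermReal y c k - ((k : ℝ) + 2) * gaussTermReal y c (k + 1) := by
  have hd : 0 < c - 2 * y := by linarith
  -- With $m=k+1$, the bound $(m(c-2y)-y^2)/(c+m)\ge(c-2y)/2$ is equivalent to $m(c-2y)\ge
  -- c(c-2y)+2y^2$.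
  obtain ⟨N, hN⟩ := exists_nat_ge ((c * (c - 2 * y) + 2 * y ^ 2) / (c - 2 * y))
  refine ⟨N, fun k hk => ?_⟩
  rw [gaussTermReal_telescope y hc, mul_comm]
  refine mul_le_mul_of_nonneg_left ?_ (gaussTermReal_nonneg y hc k)
  have hk' : (N : ℝ) ≤ k := by exact_mod_cast hk
  rw [div_le_iff₀ hd] at hN
  have := mul_le_mul_of_nonneg_right hk' hd.le
  have h3 : 0 < c + ((k : ℝ) + 1) := by positivity
  rw [le_div_iff₀ h3]
  nlinarith

theorem summable_gaussTermReal (y : ℝ) {c : ℝ} (hc : 0 < c) (hcy : 2 * y < c) :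
    Summable (gaussTermReal y c) := by
  have hd : 0 < (c - 2 * y) / 2 := by linarith
  obtain ⟨N, hN⟩ := mul_gaussTermReal_eventually_antitone y hc hcy
  rw [← summable_nat_add_iff N]
  refine summable_of_sum_range_le (c := ((N : ℝ) + 1) * gaussTermReal y c N / ((c - 2 * y) / 2))
    (fun n => gaussTermReal_nonneg y hc _) fun n => ?_
  rw [le_div_iff₀ hd, mul_comm]
  have key : (c - 2 * y) / 2 * ∑ i ∈ Finset.range n, gaussTermReal y c (i + N)
      ≤ ((N : ℝ) + 1) * gaussTermReal y c N
        - (((n + N : ℕ) : ℝ) + 1) * gaussTermReal y c (n + N) := by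
    induction n with
    | zero => simp
    | succ n ih =>
      rw [Finset.sum_range_succ, mul_add]
      have := hN (n + N) (by omega)
      rw [show n + 1 + N = n + N + 1 by omega]
      push_cast at this ih ⊢
      linarith
  have := gaussTermReal_nonneg y hc (n + N)
  have : 0 ≤ (((n + N : ℕ) : ℝ) + 1) * gaussTermReal y c (n + N) := by positivity
  linarith

open Filter Topology in
-- The sequence is eventually decreasing and nonnegative, so it converges; summability forces the
-- limit to be $0$.
theorem tendsto_mul_gaussTermReal (y : ℝ) {c : ℝ} (hc : 0 < c) (hcy : 2 * y < c) :
    Tendsto (fun k : ℕ => ((k : ℝ) + 1) * gaussTermReal y c k) atTop (𝓝 0) := by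
  obtain ⟨N, hN⟩ := mul_gaussTermReal_eventually_antitone y hc hcy
  have hanti : Antitone (fun k : ℕ => (((k + N : ℕ) : ℝ) + 1) * gaussTermReal y c (k + N)) := by
    refine antitone_nat_of_succ_le fun k => ?_
    have h1 := hN (k + N) (by omega)
    have h2 : 0 ≤ (c - 2 * y) / 2 * gaussTermReal y c (k + N) :=
      mul_nonneg (by linarith) (gaussTermReal_nonneg y hc _)
    rw [show k + 1 + N = k + N + 1 by omega]
    push_cast at h1 ⊢
    linarith
  obtain h | ⟨l, hl⟩ := tendsto_atTop_of_antitone hanti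
  · exfalso
    obtain ⟨k, hk⟩ := (h.eventually (eventually_lt_atBot 0)).exists
    have := gaussTermReal_nonneg y hc (k + N)
    have : 0 ≤ (((k + N : ℕ) : ℝ) + 1) * gaussTermReal y c (k + N) := by positivity
    linarith
  · have hl' := (tendsto_add_atTop_iff_nat
      (f := fun k : ℕ => ((k : ℝ) + 1) * gaussTermReal y c k) N).mp hl
    rwa [tendsto_zero_of_summable_of_tendsto_mul (summable_gaussTermReal y hc hcy) hl'] at hl'

theorem summable_gaussTerm (y : ℝ) {c : ℂ} (hc : 0 < c.re) (hcy : 2 * y < c.re) :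
    Summable (gaussTerm y c) :=
  .of_norm_bounded (summable_gaussTermReal y hc hcy) (norm_gaussTerm_le y hc le_rfl)

open Filter Topology in
/-- Gauss's contiguous relation. -/
theorem one_add_tsum_gaussTerm_contiguous (y : ℝ) {c : ℂ} (hc : 0 < c.re) (hcy : 2 * y < c.re) :
    c * (c - 2 * y) * (1 + y ^ 2 * ∑' k, gaussTerm y c k)
      = (c - y) ^ 2 * (1 + y ^ 2 * ∑' k, gaussTerm y (c + 1) k) := by
  have hs := (summable_gaussTerm y hc hcy).hasSum
  have hs1 := (summable_gaussTerm y (c := c + 1) (by simp; linarith)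
    (by simp; linarith)).hasSum
  have h1 := (hs.mul_left (c * (c - 2 * y))).sub (hs1.mul_left ((c - y) ^ 2))
  have h5 : c ≠ 0 := by rintro rfl; simp at hc
  have hE : Tendsto (fun k : ℕ => c * (((k : ℂ) + 1) * gaussTerm y c k)) atTop (𝓝 0) := by
    rw [← mul_zero c]
    refine Tendsto.const_mul c (squeeze_zero_norm (fun k => ?_)
      (tendsto_mul_gaussTermReal y hc hcy))
    rw [norm_mul]
    refine mul_le_mul (le_of_eq ?_) (norm_gaussTerm_le y hc le_rfl k) (norm_nonneg _)
      (by positivity)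
    exact_mod_cast Complex.norm_natCast (k + 1)
  -- The $1$ is the boundary value at $k=0$. Multiplied by $y^2$, it compensates
  -- $c(c-2y)-(c-y)^2=-y^2$ in the final identity.
  have h2 : ∀ n : ℕ, ∑ k ∈ Finset.range n, (c * (c - 2 * y) * gaussTerm y c k
      - (c - y) ^ 2 * gaussTerm y (c + 1) k) = 1 - c * (((n : ℂ) + 1) * gaussTerm y c n) := by
    intro n
    induction n with
    | zero => simp [gaussTerm, h5]
    | succ n ih =>
      rw [Finset.sum_range_succ, ih, gaussTerm_telescope y hc]
      push_cast
      ring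
  have h3 := h1.tendsto_sum_nat
  simp only [h2] at h3
  have h4 := tendsto_nhds_unique h3 (hE.const_sub 1)
  linear_combination (y : ℂ) ^ 2 * h4

open Filter Topology in
theorem tendsto_one_add_tsum_gaussTerm (y : ℝ) {c : ℂ} (hc : 0 < c.re) (hcy : 2 * y < c.re) :
    Tendsto (fun n : ℕ => 1 + (y : ℂ) ^ 2 * ∑' k, gaussTerm y (c + n) k) atTop (𝓝 1) := by
  have h := tendsto_tsum_of_dominated_convergence (𝓕 := atTop)
    (f := fun (n : ℕ) k => gaussTerm y (c + n) k) (g := fun _ => 0)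
    (summable_gaussTermReal y hc hcy) ?_
    (Eventually.of_forall fun n k => norm_gaussTerm_le y hc (by simp) k)
  · simpa using (h.const_mul ((y : ℂ) ^ 2)).const_add 1
  · intro k
    have hlin : Tendsto (fun n : ℕ => c.re + (n : ℝ)) atTop atTop :=
      tendsto_atTop_add_const_left _ _ tendsto_natCast_atTop_atTop
    -- In $(c+n)_{k+1}=(c+n)(c+n+1)_k$ the first factor gives the decay in $n$; in the real bound
    -- the second is at least $(\operatorname{Re}c+1)_k$.
    refine squeeze_zero_norm
      (a := fun n : ℕ => ((ascPochhammer ℝ k).eval (y + 1)) ^ 2 * (c.re + n)⁻¹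
        * ((ascPochhammer ℝ k).eval (c.re + 1))⁻¹) (fun n => ?_) ?_
    · have hr : 0 < c.re + (n : ℝ) := by positivity
      refine (norm_gaussTerm_le y hr (by simp) k).trans ?_
      have h1 : (ascPochhammer ℝ (k + 1)).eval (c.re + n)
          = (c.re + n) * (ascPochhammer ℝ k).eval (c.re + n + 1) := by
        rw [ascPochhammer_succ_left, Polynomial.eval_mul, Polynomial.eval_comp]
        simp
      have h2 : (ascPochhammer ℝ k).eval (c.re + 1) ≤ (ascPochhammer ℝ k).eval (c.re + n + 1) := by
        have := ascPochhammer_eval_le_norm (c := ((c.re + n + 1 : ℝ) : ℂ)) (r := c.re + 1)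
          (by positivity) (by simp) k
        have h4 := ascPochhammer_pos k (c.re + n + 1) (by positivity)
        have h5 : (ascPochhammer ℂ k).eval ((c.re + n + 1 : ℝ) : ℂ)
            = (((ascPochhammer ℝ k).eval (c.re + n + 1) : ℝ) : ℂ) := by
          rw [← ascPochhammer_map (algebraMap ℝ ℂ), Polynomial.eval_map]
          exact Polynomial.eval₂_at_apply (algebraMap ℝ ℂ) _
        rwa [h5, Complex.norm_real, Real.norm_of_nonneg h4.le] at this
      have h3 := ascPochhammer_pos k (c.re + 1) (by positivity)
      have h6 : (1 : ℝ) ≤ (k + 1).factorial := by exact_mod_cast Nat.factorial_pos _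
      rw [gaussTermReal, h1, mul_assoc, ← mul_inv, ← div_eq_mul_inv]
      refine div_le_div_of_nonneg_left (sq_nonneg _) (by positivity) ?_
      calc (c.re + n) * (ascPochhammer ℝ k).eval (c.re + 1)
          ≤ 1 * ((c.re + n) * (ascPochhammer ℝ k).eval (c.re + n + 1)) := by
            rw [one_mul]; gcongr
        _ ≤ _ := mul_le_mul_of_nonneg_right h6 (mul_nonneg hr.le (h3.le.trans h2))
    · simpa using ((hlin.inv_tendsto_atTop).const_mul
        (((ascPochhammer ℝ k).eval (y + 1)) ^ 2)).mul_const
        (((ascPochhammer ℝ k).eval (c.re + 1))⁻¹)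

open Filter Topology in
/-- Gauss's summation theorem for `₂F₁(y, y; c; 1)`. -/
theorem one_add_tsum_gaussTerm (y : ℝ) {c : ℂ} (hc : 0 < c.re) (hcy : 2 * y < c.re) :
    1 + (y : ℂ) ^ 2 * ∑' k, gaussTerm y c k
      = Gamma c * Gamma (c - 2 * y) / Gamma (c - y) ^ 2 := by
  set F : ℂ → ℂ := fun c => 1 + (y : ℂ) ^ 2 * ∑' k, gaussTerm y c k with hF
  have hne : ∀ {w : ℂ}, 0 < w.re → ∀ j : ℕ, w + j ≠ 0 := by
    intro w hw j h
    have := congrArg re h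
    simp only [add_re, natCast_re, zero_re] at this
    have : (0 : ℝ) ≤ j := j.cast_nonneg
    linarith
  have h2 : 0 < (c - 2 * y).re := by simpa using hcy
  have h1 : 0 < (c - y).re := by simp only [sub_re, ofReal_re]; linarith
  have hprod : ∀ {w : ℂ}, 0 < w.re → ∀ n : ℕ, ∏ j ∈ Finset.range n, (w + j) ≠ 0 :=
    fun hw n => Finset.prod_ne_zero_iff.mpr fun j _ => hne hw j
  have hiter : ∀ n : ℕ, F c = (∏ j ∈ Finset.range n, (c - y + j)) ^ 2
      / ((∏ j ∈ Finset.range n, (c + j)) * ∏ j ∈ Finset.range n, (c - 2 * y + j)) * F (c + n) := by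
    intro n
    induction n with
    | zero => simp
    | succ n ih =>
      have hcn : 0 < (c + n).re := by simp only [add_re, natCast_re]; positivity
      have hn0 : (0 : ℝ) ≤ n := n.cast_nonneg
      have hcont := one_add_tsum_gaussTerm_contiguous y hcn
        (by simp only [add_re, natCast_re]; linarith)
      have e1 := hne hc n
      have e2 := hne h2 n
      have hF1 : F (c + n) = (c - y + n) ^ 2 / ((c + n) * (c - 2 * y + n)) * F (c + (n + 1 : ℕ)) := by
        rw [div_mul_eq_mul_div, eq_div_iff (mul_ne_zero e1 e2)]
        simp only [hF]
        push_cast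
        rw [← add_assoc]
        linear_combination hcont
      rw [ih, hF1, Finset.prod_range_succ, Finset.prod_range_succ, Finset.prod_range_succ]
      have := hprod hc n
      have := hprod h2 n
      field_simp
  -- The products are those in Euler's limit for $\Gamma$, which run over $j\le n$, hence the shift
  -- $n+1$. The powers of $n$ cancel because $c+(c-2y)=2(c-y)$.
  have hseq : ∀ᶠ n : ℕ in atTop, F c
      = GammaSeq c n * GammaSeq (c - 2 * y) n / GammaSeq (c - y) n ^ 2 * F (c + (n + 1 : ℕ)) := by
    filter_upwards [eventually_ge_atTop 1] with n hn
    rw [hiter (n + 1)]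
    congr 1
    have hn' : (n : ℂ) ≠ 0 := Nat.cast_ne_zero.mpr (by omega)
    have hf : (n.factorial : ℂ) ≠ 0 := Nat.cast_ne_zero.mpr (Nat.factorial_ne_zero n)
    have hp : (n : ℂ) ^ c * (n : ℂ) ^ (c - 2 * y) = ((n : ℂ) ^ (c - y)) ^ 2 := by
      rw [sq, ← cpow_add _ _ hn', ← cpow_add _ _ hn']
      congr 1; ring
    have hp0 : (n : ℂ) ^ (c - y) ≠ 0 := by simp [cpow_eq_zero_iff, hn']
    have hA := hprod hc (n + 1)
    have hB := hprod h2 (n + 1)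
    have hC := hprod h1 (n + 1)
    simp only [GammaSeq]
    generalize ∏ j ∈ Finset.range (n + 1), (c + (j : ℂ)) = A at *
    generalize ∏ j ∈ Finset.range (n + 1), (c - 2 * y + (j : ℂ)) = B at *
    generalize ∏ j ∈ Finset.range (n + 1), (c - y + (j : ℂ)) = C at *
    generalize (n : ℂ) ^ c = X at *
    generalize (n : ℂ) ^ (c - 2 * y) = Y at *
    generalize (n : ℂ) ^ (c - y) = Z at *
    field_simp
    linear_combination (-1 : ℂ) * hp
  have hlim : Tendsto (fun n : ℕ => GammaSeq c n * GammaSeq (c - 2 * y) n / GammaSeq (c - y) n ^ 2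
      * F (c + (n + 1 : ℕ))) atTop
      (𝓝 (Gamma c * Gamma (c - 2 * y) / Gamma (c - y) ^ 2 * 1)) := by
    refine ((((GammaSeq_tendsto_Gamma c).mul (GammaSeq_tendsto_Gamma _)).div
      ((GammaSeq_tendsto_Gamma _).pow 2)
      (pow_ne_zero 2 (Gamma_ne_zero_of_re_pos h1)))).mul ?_
    exact (tendsto_add_atTop_iff_nat (f := fun n : ℕ => F (c + n)) 1).mpr
      (tendsto_one_add_tsum_gaussTerm y hc hcy)
  rw [mul_one] at hlim
  exact tendsto_nhds_unique (tendsto_const_nhds.congr' hseq) hlim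

/-! ### Gamma and beta integrals on vertical lines -/

theorem Complex.ofReal_cpow_eq_exp {x : ℝ} (hx : 0 < x) (s : ℂ) :
    (x : ℂ) ^ s = Complex.exp (s * Real.log x) := by
  rw [cpow_def_of_ne_zero (ofReal_ne_zero.mpr hx.ne'), ← ofReal_log hx.le, mul_comm]

theorem Complex.norm_Gamma_le {z : ℂ} (hz : 0 < z.re) : ‖Gamma z‖ ≤ Real.Gamma z.re := by
  rw [Gamma_eq_integral hz, Real.Gamma_eq_integral hz, GammaIntegral]
  refine (norm_integral_le_integral_norm _).trans (le_of_eq ?_)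
  refine setIntegral_congr_fun measurableSet_Ioi fun t ht => ?_
  have ht' : (0 : ℝ) < t := ht
  simp only [norm_mul, Complex.norm_real, norm_cpow_eq_rpow_re_of_pos ht']
  rw [Real.norm_of_nonneg (Real.exp_pos _).le]
  simp

theorem integrableOn_cpow_mul_one_sub_cpow {u v : ℂ} (hu : 0 < u.re) (hv : 0 < v.re) :
    IntegrableOn (fun t : ℝ => (t : ℂ) ^ (u - 1) * (1 - (t : ℂ)) ^ (v - 1)) (Ioo 0 1) := by
  have := betaIntegral_convergent hu hv
  rwa [intervalIntegrable_iff_integrableOn_Ioo_of_le zero_le_one] at this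

theorem integral_cpow_mul_one_sub_cpow {u v : ℂ} (hu : 0 < u.re) (hv : 0 < v.re) :
    ∫ t in Ioo (0 : ℝ) 1, (t : ℂ) ^ (u - 1) * (1 - (t : ℂ)) ^ (v - 1)
      = Gamma u * Gamma v / Gamma (u + v) := by
  rw [← betaIntegral_eq_Gamma_mul_div u v hu hv, betaIntegral,
    intervalIntegral.integral_of_le zero_le_one, integral_Ioc_eq_integral_Ioo]

theorem norm_cpow_mul_one_sub_cpow (u v : ℂ) {t : ℝ} (ht : t ∈ Ioo (0 : ℝ) 1) :
    ‖(t : ℂ) ^ (u - 1) * (1 - (t : ℂ)) ^ (v - 1)‖ = t ^ (u.re - 1) * (1 - t) ^ (v.re - 1) := by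
  have h1 : (1 - (t : ℂ)) = ((1 - t : ℝ) : ℂ) := by push_cast; rfl
  rw [norm_mul, h1, norm_cpow_eq_rpow_re_of_pos ht.1, norm_cpow_eq_rpow_re_of_pos (sub_pos.mpr ht.2)]
  simp

theorem integrableOn_rpow_mul_one_sub_rpow {u v : ℝ} (hu : 0 < u) (hv : 0 < v) :
    IntegrableOn (fun t : ℝ => t ^ (u - 1) * (1 - t) ^ (v - 1)) (Ioo 0 1) := by
  refine (integrableOn_cpow_mul_one_sub_cpow (u := u) (v := v) (by simpa) (by simpa)).norm.congr ?_
  filter_upwards [ae_restrict_mem measurableSet_Ioo] with t ht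
  simpa using norm_cpow_mul_one_sub_cpow (u : ℂ) (v : ℂ) ht

theorem integral_rpow_mul_one_sub_rpow {u v : ℝ} (hu : 0 < u) (hv : 0 < v) :
    ∫ t in Ioo (0 : ℝ) 1, t ^ (u - 1) * (1 - t) ^ (v - 1)
      = Real.Gamma u * Real.Gamma v / Real.Gamma (u + v) := by
  have h := integral_cpow_mul_one_sub_cpow (u := u) (v := v) (by simpa) (by simpa)
  rw [← ofReal_add, Gamma_ofReal, Gamma_ofReal, Gamma_ofReal] at h
  rw [← ofReal_inj, ofReal_div, ofReal_mul, ← h]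
  refine (integral_ofReal (𝕜 := ℂ)).symm.trans ?_
  refine setIntegral_congr_fun measurableSet_Ioo fun t ht => ?_
  simp only [coe_algebraMap]
  rw [ofReal_mul, ofReal_cpow ht.1.le, ofReal_cpow (sub_nonneg.mpr ht.2.le)]
  push_cast
  rfl

/-- The triangle inequality in Euler's beta integral. The bound ignores imaginary parts, so it
controls Gamma quotients on vertical lines without Stirling's formula. -/
theorem norm_Gamma_mul_Gamma_div_le {u v : ℂ} (hu : 0 < u.re) (hv : 0 < v.re) :
    ‖Gamma u * Gamma v / Gamma (u + v)‖
      ≤ Real.Gamma u.re * Real.Gamma v.re / Real.Gamma (u.re + v.re) := by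
  rw [← integral_cpow_mul_one_sub_cpow hu hv, ← integral_rpow_mul_one_sub_rpow hu hv]
  refine (norm_integral_le_integral_norm _).trans (le_of_eq ?_)
  exact setIntegral_congr_fun measurableSet_Ioo fun t ht => norm_cpow_mul_one_sub_cpow u v ht

theorem continuous_Gamma_comp {f : ℝ → ℂ} (hf : Continuous f) (h : ∀ t, 0 < (f t).re) :
    Continuous (fun t => Gamma (f t)) := by
  refine continuous_iff_continuousAt.mpr fun t => ?_
  refine ContinuousAt.comp (g := Gamma) (differentiableAt_Gamma _ fun m hm => ?_).continuousAt
    hf.continuousAt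
  have := h t
  rw [hm, neg_re, natCast_re] at this
  have : (0 : ℝ) ≤ m := m.cast_nonneg
  linarith

theorem integrable_inv_sq_add_sq {σ : ℝ} (hσ : 0 < σ) (x : ℝ) :
    Integrable (fun τ : ℝ => (σ ^ 2 + (τ + x) ^ 2)⁻¹) := by
  have h := ((integrable_inv_one_add_sq.comp_mul_left' (inv_ne_zero hσ.ne')).const_mul
    (σ ^ 2)⁻¹).comp_add_right x
  refine h.congr (Filter.Eventually.of_forall fun τ => ?_)
  simp only
  rw [← mul_inv]
  congr 1
  field_simp

/-- The product `Γ(p + ix) Γ(p - ix)` is integrable on vertical lines in the right half-plane. -/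
theorem integrable_Gamma_mul_Gamma {σ : ℝ} (hσ : 0 < σ) (x : ℝ) :
    Integrable (fun τ : ℝ => Gamma (σ + τ * I + I * x) * Gamma (σ + τ * I - I * x)) := by
  have hre1 : ∀ τ : ℝ, (σ + τ * I + I * x : ℂ).re = σ := fun τ => by simp
  have hre2 : ∀ τ : ℝ, (σ + τ * I - I * x : ℂ).re = σ := fun τ => by simp
  have him1 : ∀ τ : ℝ, (σ + τ * I + I * x : ℂ).im = τ + x := fun τ => by simp
  have him2 : ∀ τ : ℝ, (σ + τ * I - I * x : ℂ).im = τ + -x := fun τ => by simp [sub_eq_add_neg]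
  -- Writing $\Gamma(z)=\Gamma(z+1)/z$ and bounding $\Gamma(z+1)$ on the line gains an integrable
  -- $|z|^{-2}$.
  have hb : ∀ z : ℂ, z.re = σ → ‖Gamma z‖ ^ 2
      ≤ Real.Gamma (σ + 1) ^ 2 * (σ ^ 2 + z.im ^ 2)⁻¹ := by
    intro z hz
    have hz0 : z ≠ 0 := by rintro rfl; simp at hz; linarith
    have h1 := norm_Gamma_le (z := z + 1) (by simp [hz]; linarith)
    rw [Gamma_add_one z hz0, add_re, one_re, hz, norm_mul] at h1
    have h2 : σ ^ 2 + z.im ^ 2 = ‖z‖ ^ 2 := by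
      rw [← normSq_eq_norm_sq, normSq_apply, hz]; ring
    have h3 : 0 < ‖z‖ := norm_pos_iff.mpr hz0
    rw [h2, ← div_eq_mul_inv, le_div_iff₀ (by positivity), ← mul_pow, mul_comm]
    exact pow_le_pow_left₀ (by positivity) h1 2
  refine (((integrable_inv_sq_add_sq hσ x).const_mul (Real.Gamma (σ + 1) ^ 2)).add
    ((integrable_inv_sq_add_sq hσ (-x)).const_mul (Real.Gamma (σ + 1) ^ 2))).mono' ?_
    (Filter.Eventually.of_forall fun τ => ?_)
  · exact ((continuous_Gamma_comp (by fun_prop) fun τ => (hre1 τ).symm ▸ hσ).mul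
      (continuous_Gamma_comp (by fun_prop) fun τ => (hre2 τ).symm ▸ hσ)).aestronglyMeasurable
  · have h1 := hb _ (hre1 τ)
    have h2 := hb _ (hre2 τ)
    rw [him1] at h1
    rw [him2] at h2
    rw [norm_mul, Pi.add_apply]
    nlinarith [sq_nonneg (‖Gamma (σ + τ * I + I * x)‖ - ‖Gamma (σ + τ * I - I * x)‖),
      sq_nonneg (‖Gamma (σ + τ * I + I * x)‖ + ‖Gamma (σ + τ * I - I * x)‖)]

/-- The substitution `t = e^r / (2 cosh r)` in Euler's beta integral. -/
theorem integrable_and_integral_exp_mul_cosh_cpow {p μ : ℂ} (h1 : 0 < (p + μ).re)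
    (h2 : 0 < (p - μ).re) :
    Integrable (fun r : ℝ => Complex.exp (2 * μ * r) * ((2 * Real.cosh r : ℝ) : ℂ) ^ (-(2 * p))) ∧
    ∫ r : ℝ, Complex.exp (2 * μ * r) * ((2 * Real.cosh r : ℝ) : ℂ) ^ (-(2 * p))
      = 1 / 2 * (Gamma (p + μ) * Gamma (p - μ) / Gamma (2 * p)) := by
  have hD : ∀ r : ℝ, 0 < 2 * Real.cosh r := fun r => by have := Real.cosh_pos r; positivity
  set f : ℝ → ℝ := fun r => Real.exp r / (2 * Real.cosh r) with hf
  have hcs : ∀ r : ℝ, 2 * Real.cosh r = Real.exp r + Real.exp (-r) := fun r => by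
    rw [Real.cosh_eq]; ring
  have hf1 : ∀ r, 1 - f r = Real.exp (-r) / (2 * Real.cosh r) := fun r => by
    have := (hD r).ne'
    rw [hf, eq_div_iff this, sub_mul, one_mul, div_mul_cancel₀ _ this, hcs]
    ring
  have hfpos : ∀ r, 0 < f r := fun r => div_pos (Real.exp_pos _) (hD r)
  have hfpos1 : ∀ r, 0 < 1 - f r := fun r => by rw [hf1]; exact div_pos (Real.exp_pos _) (hD r)
  have hderiv : ∀ r, HasDerivAt f (2 * (f r * (1 - f r))) r := by
    intro r
    have h := (Real.hasDerivAt_exp r).div ((Real.hasDerivAt_cosh r).const_mul 2) (hD r).ne'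
    refine h.congr_deriv ?_
    have h3 : 2 * Real.sinh r = Real.exp r - Real.exp (-r) := by rw [Real.sinh_eq]; ring
    rw [hf1, hf, h3]
    have := (hD r).ne'
    rw [div_mul_div_comm, ← mul_div_assoc, sq]
    congr 1
    rw [hcs]
    ring
  have himage : f '' univ = Ioo 0 1 := by
    ext t
    constructor
    · rintro ⟨r, -, rfl⟩
      exact ⟨hfpos r, sub_pos.mp (hfpos1 r)⟩
    · rintro ⟨ht0, ht1⟩
      have ht1' : 0 < 1 - t := sub_pos.mpr ht1
      refine ⟨Real.log (t / (1 - t)) / 2, mem_univ _, ?_⟩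
      set r := Real.log (t / (1 - t)) / 2 with hr
      have he : Real.exp r * Real.exp r = t / (1 - t) := by
        rw [← Real.exp_add, hr, add_halves, Real.exp_log (by positivity)]
      have he' : Real.exp (-r) * Real.exp r = 1 := by rw [← Real.exp_add]; simp
      rw [hf]
      simp only
      rw [div_eq_iff (hD r).ne', hcs]
      have hne := (Real.exp_pos r).ne'
      have h3 : Real.exp r * Real.exp r * (1 - t) = t := by rw [he]; field_simp
      apply mul_right_cancel₀ hne
      linear_combination h3 - t * he'
  have hinj : InjOn f univ := by
    have : StrictMono f := strictMono_of_deriv_pos fun r => by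
      rw [(hderiv r).deriv]
      exact mul_pos two_pos (mul_pos (hfpos r) (hfpos1 r))
    exact this.injective.injOn
  -- The Jacobian $2t(1-t)$ raises both exponents by one, leaving $2t^{p+\mu}(1-t)^{p-\mu}=2e^{2\mu
  -- r}(2\cosh r)^{-2p}$.
  have hcongr : ∀ r : ℝ, |2 * (f r * (1 - f r))| •
      (((f r : ℝ) : ℂ) ^ (p + μ - 1) * (1 - ((f r : ℝ) : ℂ)) ^ (p - μ - 1))
      = 2 * (Complex.exp (2 * μ * r) * ((2 * Real.cosh r : ℝ) : ℂ) ^ (-(2 * p))) := by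
    intro r
    have e1 : (1 - ((f r : ℝ) : ℂ)) = ((1 - f r : ℝ) : ℂ) := by push_cast; rfl
    have hp1 := hfpos r
    have hp2 := hfpos1 r
    rw [abs_of_pos (by positivity), e1,
      cpow_sub _ _ (ofReal_ne_zero.mpr hp1.ne'), cpow_sub _ _ (ofReal_ne_zero.mpr hp2.ne'),
      cpow_one, cpow_one, ofReal_cpow_eq_exp hp1, ofReal_cpow_eq_exp hp2,
      ofReal_cpow_eq_exp (hD r), hf1, hf]
    simp only
    rw [Real.log_div (Real.exp_pos _).ne' (hD r).ne', Real.log_exp,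
      Real.log_div (Real.exp_pos _).ne' (hD r).ne', Real.log_exp, real_smul]
    have e2 : Complex.exp ((p + μ) * ((r - Real.log (2 * Real.cosh r) : ℝ) : ℂ))
        * Complex.exp ((p - μ) * ((-r - Real.log (2 * Real.cosh r) : ℝ) : ℂ))
        = Complex.exp (2 * μ * r) * Complex.exp (-(2 * p) * (Real.log (2 * Real.cosh r) : ℝ)) := by
      rw [← Complex.exp_add, ← Complex.exp_add]
      congr 1
      push_cast
      ring
    rw [← e2]
    have hA : ((Real.exp r / (2 * Real.cosh r) : ℝ) : ℂ) ≠ 0 :=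
      ofReal_ne_zero.mpr (div_pos (Real.exp_pos _) (hD r)).ne'
    have hB : ((Real.exp (-r) / (2 * Real.cosh r) : ℝ) : ℂ) ≠ 0 :=
      ofReal_ne_zero.mpr (div_pos (Real.exp_pos _) (hD r)).ne'
    rw [ofReal_mul, ofReal_mul, ofReal_ofNat]
    field_simp
  have hint := integrableOn_cpow_mul_one_sub_cpow h1 h2
  have hval := integral_cpow_mul_one_sub_cpow h1 h2
  rw [← himage, integrableOn_image_iff_integrableOn_abs_deriv_smul MeasurableSet.univ
    (fun r _ => (hderiv r).hasDerivWithinAt) hinj, integrableOn_univ] at hint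
  rw [← himage, integral_image_eq_integral_abs_deriv_smul MeasurableSet.univ
    (fun r _ => (hderiv r).hasDerivWithinAt) hinj, setIntegral_univ] at hval
  simp only [hcongr] at hint hval
  rw [integral_const_mul, show p + μ + (p - μ) = 2 * p by ring] at hval
  refine ⟨?_, ?_⟩
  · have := hint.const_mul (1 / 2)
    simpa [← mul_assoc] using this
  · rw [← hval]; ring

/-! ### The product of two Macdonald functions and its Mellin transform -/

/-- The integrand of the double integral representing `K_{y+ix}(b) K_{y-ix}(b)`. -/
noncomputable def macdonaldKernel (x y b : ℝ) (z : ℝ × ℝ) : ℂ :=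
  (Real.exp (-(2 * Real.cosh z.1 * Real.cosh z.2 * b)) : ℂ)
    * (Complex.exp (2 * (I * x) * z.1) * Complex.exp (2 * y * z.2))

theorem norm_macdonaldKernel (x y b : ℝ) (z : ℝ × ℝ) :
    ‖macdonaldKernel x y b z‖
      = Real.exp (-(2 * Real.cosh z.1 * Real.cosh z.2 * b)) * Real.exp (2 * y * z.2) := by
  rw [macdonaldKernel, norm_mul, norm_mul, Complex.norm_real,
    Real.norm_of_nonneg (Real.exp_pos _).le, Complex.norm_exp, Complex.norm_exp]
  simp

theorem integrable_macdonaldKernel (x y : ℝ) {b : ℝ} (hb : 0 < b) :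
    Integrable (macdonaldKernel x y b) (volume.prod volume) := by
  have h := (integrable_exp_neg_cosh_mul_exp hb 0).mul_prod
    (integrable_exp_neg_cosh_mul_exp hb |2 * y|)
  refine h.mono' ?_ (Filter.Eventually.of_forall fun z => ?_)
  · unfold macdonaldKernel
    fun_prop
  · rw [norm_macdonaldKernel, zero_mul, Real.exp_zero, mul_one, ← mul_assoc,
      ← Real.exp_add (-b * _) (-b * _)]
    have h1 := Real.one_le_cosh z.1
    have h2 := Real.one_le_cosh z.2
    refine mul_le_mul (Real.exp_le_exp.mpr ?_) (Real.exp_le_exp.mpr ?_) (Real.exp_pos _).le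
      (Real.exp_pos _).le
    -- For $A,B\ge1$ one has $A+B\le2AB$, which splits the majorant into a product.
    · have : Real.cosh z.1 + Real.cosh z.2 ≤ 2 * Real.cosh z.1 * Real.cosh z.2 := by nlinarith
      have := mul_le_mul_of_nonneg_right this hb.le
      linarith
    · exact (le_abs_self _).trans (abs_mul _ _).le

/-- With $q=(v-u)/2$ and $r=(u+v)/2$, $\cosh u+\cosh v=2\cosh q\cosh r$ and
$(y-ix)u+(y+ix)v=2ixq+2yr$. The change of variables is composed of measure-preserving shears and one
scaling by $2$. -/
theorem macdonaldK_mul_eq_integral (x y : ℝ) {b : ℝ} (hb : 0 < b) :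
    macdonaldK (y + I * x) b * macdonaldK (y - I * x) b
      = 1 / 2 * ∫ z : ℝ × ℝ, macdonaldKernel x y b z ∂(volume.prod volume) := by
  set f : ℝ → ℂ := fun u => (Real.exp (-b * Real.cosh u) : ℂ) * Complex.exp ((y - I * x) * u)
  set g : ℝ → ℂ := fun u => (Real.exp (-b * Real.cosh u) : ℂ) * Complex.exp ((y + I * x) * u)
  have hf : Integrable f := integrable_exp_neg_cosh_mul_cexp hb _
  have hg : Integrable g := integrable_exp_neg_cosh_mul_cexp hb _
  have hmp := measurePreserving_prod_add (volume : Measure ℝ) (volume : Measure ℝ)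
  have hme : MeasurableEmbedding (fun z : ℝ × ℝ => (z.1, z.1 + z.2)) :=
    (MeasurableEquiv.shearAddRight ℝ).measurableEmbedding
  set K : ℝ × ℝ → ℂ := fun z => f z.1 * g (z.1 + z.2)
  have hK : Integrable K (volume.prod volume) :=
    (hmp.integrable_comp_emb hme).mpr (hf.mul_prod hg)
  have hKint : ∫ z, K z ∂(volume.prod volume) = (∫ u, f u) * ∫ u, g u := by
    rw [← integral_prod_mul]
    exact hmp.integral_comp hme (fun z : ℝ × ℝ => f z.1 * g z.2)
  have hG : ∀ z : ℝ × ℝ, macdonaldKernel x y b (z.1, z.1 + z.2) = K (z.2, 2 * z.1) := by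
    rintro ⟨q, w⟩
    simp only [macdonaldKernel, K, f, g]
    rw [mul_mul_mul_comm, ← ofReal_mul, ← Real.exp_add, ← Complex.exp_add, ← Complex.exp_add]
    congr 2
    · have h1 : Real.cosh (w + 2 * q) + Real.cosh w = 2 * Real.cosh q * Real.cosh (q + w) := by
        rw [show w + 2 * q = (q + w) + q by ring, show Real.cosh w = Real.cosh ((q + w) - q) by
          ring_nf, Real.cosh_add (q + w) q, Real.cosh_sub (q + w) q]
        ring
      congr 1
      linear_combination b * h1
    · push_cast
      ring
  have hH : Integrable (fun z : ℝ × ℝ => K (z.2, 2 * z.1)) (volume.prod volume) := by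
    have := (hmp.integrable_comp_emb hme).mpr (integrable_macdonaldKernel x y hb)
    exact this.congr (Filter.Eventually.of_forall hG)
  have hHint : ∫ z, macdonaldKernel x y b z ∂(volume.prod volume)
      = ∫ z : ℝ × ℝ, K (z.2, 2 * z.1) ∂(volume.prod volume) := by
    rw [← hmp.integral_comp hme]
    exact integral_congr_ae (Filter.Eventually.of_forall hG)
  have hscale : ∫ z : ℝ × ℝ, K (z.2, 2 * z.1) ∂(volume.prod volume)
      = 1 / 2 * ∫ z, K z ∂(volume.prod volume) := by
    rw [integral_prod_symm _ hH, integral_prod _ hK, ← integral_const_mul]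
    refine integral_congr_ae (Filter.Eventually.of_forall fun w => ?_)
    have := Measure.integral_comp_mul_left (fun q => K (w, q)) 2
    simp only at this ⊢
    rw [this, abs_of_pos (by norm_num), real_smul]
    norm_num
  rw [hHint, hscale, hKint, macdonaldK_eq_integral hb, macdonaldK_eq_integral hb]
  ring

/-- Integrability is read off the value: a non-integrable function has integral $0$ by convention,
and the value is positive. -/
theorem integral_rpow_mul_exp_neg {s r : ℝ} (hs : 0 < s) (hr : 0 < r) :
    IntegrableOn (fun b : ℝ => b ^ (s - 1) * Real.exp (-(r * b))) (Ioi 0) ∧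
    ∫ b in Ioi (0 : ℝ), b ^ (s - 1) * Real.exp (-(r * b)) = (1 / r) ^ s * Real.Gamma s := by
  have h := Real.integral_rpow_mul_exp_neg_mul_Ioi hs hr
  refine ⟨?_, h⟩
  by_contra hc
  rw [integral_undef hc] at h
  have := Real.Gamma_pos_of_pos hs
  have : 0 < (1 / r) ^ s * Real.Gamma s := by positivity
  linarith

/-- The Mellin transform at `2p` of `b ↦ K_{y+ix}(b) K_{y-ix}(b)`. -/
theorem mellin_macdonaldK_mul (x y : ℝ) {p : ℂ} (hp : |y| < p.re) :
    MellinConvergent (fun b => macdonaldK (y + I * x) b * macdonaldK (y - I * x) b) (2 * p) ∧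
    mellin (fun b => macdonaldK (y + I * x) b * macdonaldK (y - I * x) b) (2 * p)
      = 2 ^ (2 * p) / 8 * (Gamma (p + I * x) * Gamma (p - I * x)
        * (Gamma (p + y) * Gamma (p - y) / Gamma (2 * p))) := by
  have hp0 : 0 < p.re := (abs_nonneg y).trans_lt hp
  have hy := abs_lt.mp hp
  set F : ℝ × (ℝ × ℝ) → ℂ := fun w => (w.1 : ℂ) ^ (2 * p - 1) * macdonaldKernel x y w.1 w.2 with hF
  have hD : ∀ r : ℝ, 0 < 2 * Real.cosh r := fun r => by have := Real.cosh_pos r; positivity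
  have hC : ∀ z : ℝ × ℝ, 0 < 2 * Real.cosh z.1 * Real.cosh z.2 := fun z => by
    have := Real.cosh_pos z.1
    have := Real.cosh_pos z.2
    positivity
  have hre : (2 * p).re = 2 * p.re := by simp
  have hre1 : (2 * p - 1).re = 2 * p.re - 1 := by simp
  obtain ⟨hix, hvx⟩ := integrable_and_integral_exp_mul_cosh_cpow (p := p) (μ := I * x)
    (by simpa) (by simpa)
  obtain ⟨hiy, hvy⟩ := integrable_and_integral_exp_mul_cosh_cpow (p := p) (μ := y)
    (by simp; linarith) (by simp; linarith)
  have hnorm : ∀ z : ℝ × ℝ, ∀ b : ℝ, 0 < b → ‖F (b, z)‖ = b ^ (2 * p.re - 1)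
      * Real.exp (-(2 * Real.cosh z.1 * Real.cosh z.2 * b)) * Real.exp (2 * y * z.2) := by
    intro z b hb
    simp only [hF]
    rw [norm_mul, norm_macdonaldKernel, norm_cpow_eq_rpow_re_of_pos hb, hre1]
    ring
  have hmeas : AEStronglyMeasurable F ((volume.restrict (Ioi 0)).prod (volume.prod volume)) := by
    refine Measurable.aestronglyMeasurable ?_
    simp only [hF, macdonaldKernel]
    fun_prop
  have hFint : Integrable F ((volume.restrict (Ioi 0)).prod (volume.prod volume)) := by
    rw [integrable_prod_iff' hmeas]
    constructor
    · refine Filter.Eventually.of_forall fun z => ?_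
      have h1 := (integral_rpow_mul_exp_neg (s := 2 * p.re) (by positivity) (hC z)).1.mul_const
        (Real.exp (2 * y * z.2))
      refine h1.mono' (Measurable.aestronglyMeasurable ?_) ?_
      · simp only [hF, macdonaldKernel]
        fun_prop
      · filter_upwards [ae_restrict_mem measurableSet_Ioi] with b hb
        exact (hnorm z b hb).le
    -- Integrating the modulus over $b$ gives a constant times a product of one function of each
    -- variable, namely the moduli of the two beta integrands; $|y|<\operatorname{Re}p$ makes the
    -- second integrable.
    · have h1 := ((hix.mul_prod hiy).norm).const_mul (2 ^ (2 * p.re) * Real.Gamma (2 * p.re))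
      refine h1.congr (Filter.Eventually.of_forall fun z => ?_)
      simp only
      have h2 : ∫ b in Ioi (0 : ℝ), ‖F (b, z)‖ = (1 / (2 * Real.cosh z.1 * Real.cosh z.2))
          ^ (2 * p.re) * Real.Gamma (2 * p.re) * Real.exp (2 * y * z.2) := by
        rw [← (integral_rpow_mul_exp_neg (s := 2 * p.re) (by positivity) (hC z)).2,
          ← integral_mul_const]
        exact setIntegral_congr_fun measurableSet_Ioi fun b hb => hnorm z b hb
      rw [h2, norm_mul, norm_mul, norm_mul, norm_cpow_eq_rpow_re_of_pos (hD _),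
        norm_cpow_eq_rpow_re_of_pos (hD _), Complex.norm_exp, Complex.norm_exp, neg_re, hre,
        show 2 * Real.cosh z.1 * Real.cosh z.2
          = (2 * Real.cosh z.1) * (2 * Real.cosh z.2) / 2 by ring, one_div_div,
        Real.div_rpow zero_le_two (mul_pos (hD _) (hD _)).le,
        Real.mul_rpow (hD _).le (hD _).le, Real.rpow_neg (hD _).le, Real.rpow_neg (hD _).le]
      have e1 : (2 * (I * x) * z.1 : ℂ).re = 0 := by simp
      have e2 : (2 * (y : ℂ) * z.2).re = 2 * y * z.2 := by simp
      rw [e1, e2, Real.exp_zero]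
      have := (Real.rpow_pos_of_pos (hD z.1) (2 * p.re)).ne'
      have := (Real.rpow_pos_of_pos (hD z.2) (2 * p.re)).ne'
      field_simp
  have hcongr : ∀ b ∈ Ioi (0 : ℝ), (b : ℂ) ^ (2 * p - 1) • (macdonaldK (y + I * x) b
      * macdonaldK (y - I * x) b) = 1 / 2 * ∫ z : ℝ × ℝ, F (b, z) ∂(volume.prod volume) := by
    intro b hb
    rw [macdonaldK_mul_eq_integral x y hb, smul_eq_mul]
    simp only [hF]
    rw [integral_const_mul]
    ring
  refine ⟨?_, ?_⟩
  · have h := hFint.integral_prod_left.const_mul (1 / 2)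
    exact (integrableOn_congr_fun hcongr measurableSet_Ioi).mpr h
  · rw [mellin, setIntegral_congr_fun measurableSet_Ioi hcongr, integral_const_mul,
      integral_integral_swap hFint]
    have hin : ∀ z : ℝ × ℝ, ∫ b in Ioi (0 : ℝ), F (b, z) = 2 ^ (2 * p) * Gamma (2 * p)
        * ((Complex.exp (2 * (I * x) * z.1) * ((2 * Real.cosh z.1 : ℝ) : ℂ) ^ (-(2 * p)))
        * (Complex.exp (2 * y * z.2) * ((2 * Real.cosh z.2 : ℝ) : ℂ) ^ (-(2 * p)))) := by
      intro z
      have h1 := integral_cpow_mul_exp_neg_mul_Ioi (a := 2 * p) (by rw [hre]; positivity) (hC z)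
      have h2 : ∫ b in Ioi (0 : ℝ), F (b, z) = (∫ b in Ioi (0 : ℝ), (b : ℂ) ^ (2 * p - 1)
          * Complex.exp (-(((2 * Real.cosh z.1 * Real.cosh z.2 : ℝ) : ℂ) * b)))
          * (Complex.exp (2 * (I * x) * z.1) * Complex.exp (2 * y * z.2)) := by
        rw [← integral_mul_const]
        refine integral_congr_ae (Filter.Eventually.of_forall fun b => ?_)
        simp only [hF, macdonaldKernel]
        push_cast
        ring
      have h3 : (1 / ((2 * Real.cosh z.1 * Real.cosh z.2 : ℝ) : ℂ)) ^ (2 * p)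
          = 2 ^ (2 * p) * (((2 * Real.cosh z.1 : ℝ) : ℂ) ^ (-(2 * p))
            * ((2 * Real.cosh z.2 : ℝ) : ℂ) ^ (-(2 * p))) := by
        have e : (1 / ((2 * Real.cosh z.1 * Real.cosh z.2 : ℝ) : ℂ))
            = ((2 * ((2 * Real.cosh z.1)⁻¹ * (2 * Real.cosh z.2)⁻¹) : ℝ) : ℂ) := by
          rw [one_div, ← ofReal_inv]
          congr 1
          have := (Real.cosh_pos z.1).ne'
          have := (Real.cosh_pos z.2).ne'
          field_simp
        have i1 := inv_pos.mpr (hD z.1)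
        have i2 := inv_pos.mpr (hD z.2)
        rw [e, ofReal_cpow_eq_exp (by positivity), ofReal_cpow_eq_exp (hD z.1),
          ofReal_cpow_eq_exp (hD z.2), Real.log_mul two_ne_zero (by positivity),
          Real.log_mul i1.ne' i2.ne', Real.log_inv, Real.log_inv,
          show (2 : ℂ) = ((2 : ℝ) : ℂ) by norm_num, ofReal_cpow_eq_exp two_pos,
          ← Complex.exp_add, ← Complex.exp_add]
        congr 1
        push_cast
        ring
      rw [h2, h1, h3]
      ring
    simp only [hin]
    rw [integral_const_mul, integral_prod_mul
      (fun r : ℝ => Complex.exp (2 * (I * x) * r) * ((2 * Real.cosh r : ℝ) : ℂ) ^ (-(2 * p)))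
      (fun r : ℝ => Complex.exp (2 * y * r) * ((2 * Real.cosh r : ℝ) : ℂ) ^ (-(2 * p))), hvx, hvy]
    have : Gamma (2 * p) ≠ 0 := Gamma_ne_zero_of_re_pos (by rw [hre]; positivity)
    field_simp
    norm_num
    ring

/-! ### Mellin inversion -/

theorem norm_Gamma_div_Gamma_add_le {u : ℂ} (hu : 0 < u.re) {δ : ℝ} (hδ : 0 < δ) :
    ‖Gamma u / Gamma (u + δ)‖ ≤ Real.Gamma u.re / Real.Gamma (u.re + δ) := by
  have h := norm_Gamma_mul_Gamma_div_le hu (v := (δ : ℂ)) (by simpa)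
  have h1 := Real.Gamma_pos_of_pos hδ
  rw [ofReal_re, Gamma_ofReal, mul_div_right_comm, mul_div_right_comm, norm_mul, Complex.norm_real,
    Real.norm_of_nonneg h1.le] at h
  exact le_of_mul_le_mul_right h h1

/-- Up to a constant, the Mellin transform at `2p` of `b ↦ K_{y+ix}(b) K_{y-ix}(b)`. -/
noncomputable def macdonaldMellin (x y : ℝ) (p : ℂ) : ℂ :=
  Gamma (p + I * x) * Gamma (p - I * x)
    * (Gamma (p + y) * Gamma (p - y) / (Gamma p * Gamma (p + 1 / 2)))

/-- Legendre's duplication formula, which absorbs the power of $2$. -/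
theorem two_cpow_mul_div_Gamma {p : ℂ} (hp : 0 < p.re) (A : ℂ) :
    2 ^ (2 * p) / 8 * (A / Gamma (2 * p))
      = (√Real.pi : ℝ) / 4 * (A / (Gamma p * Gamma (p + 1 / 2))) := by
  have h1 : Gamma (2 * p) ≠ 0 := Gamma_ne_zero_of_re_pos (by simpa)
  have h2 : (2 : ℂ) ^ (2 * p) ≠ 0 := by simp [cpow_eq_zero_iff]
  have h3 : ((√Real.pi : ℝ) : ℂ) ≠ 0 :=
    ofReal_ne_zero.mpr (Real.sqrt_pos.mpr Real.pi_pos).ne'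
  rw [Gamma_mul_Gamma_add_half, cpow_sub _ _ two_ne_zero, cpow_one]
  field_simp
  ring

theorem norm_two_cpow_le (p : ℂ) : ‖(2 : ℂ) ^ (2 * p)‖ = 2 ^ (2 * p.re) := by
  rw [show (2 : ℂ) = ((2 : ℝ) : ℂ) by norm_num, norm_cpow_eq_rpow_re_of_pos two_pos]
  simp

theorem mellin_macdonaldK_mul_eq (x y : ℝ) {p : ℂ} (hp : |y| < p.re) :
    mellin (fun b => macdonaldK (y + I * x) b * macdonaldK (y - I * x) b) (2 * p)
      = (√Real.pi : ℝ) / 4 * macdonaldMellin x y p := by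
  have hp0 : 0 < p.re := (abs_nonneg y).trans_lt hp
  have h := two_cpow_mul_div_Gamma hp0 (Gamma (p + y) * Gamma (p - y))
  rw [(mellin_macdonaldK_mul x y hp).2, macdonaldMellin]
  linear_combination (Gamma (p + I * x) * Gamma (p - I * x)) * h

/-- The factor with $\pm ix$ is integrable; the other is bounded on the line by the beta estimate,
after duplication restores $\Gamma(2p)$. -/
theorem integrable_macdonaldMellin (x y : ℝ) {σ : ℝ} (hσ : |y| < σ) :
    Integrable (fun τ : ℝ => macdonaldMellin x y (σ + τ * I)) := by
  have hσ0 : 0 < σ := (abs_nonneg y).trans_lt hσ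
  have hy := abs_lt.mp hσ
  have hre : ∀ τ : ℝ, (σ + τ * I : ℂ).re = σ := fun τ => by simp
  have h1 : ∀ τ : ℝ, 0 < (σ + τ * I + y : ℂ).re := fun τ => by
    rw [add_re, hre, ofReal_re]; linarith
  have h2 : ∀ τ : ℝ, 0 < (σ + τ * I - y : ℂ).re := fun τ => by
    rw [sub_re, hre, ofReal_re]; linarith
  have h3 : ∀ τ : ℝ, 0 < (σ + τ * I + 1 / 2 : ℂ).re := fun τ => by
    rw [add_re, hre]; norm_num; linarith
  have h4 : ∀ τ : ℝ, 0 < (σ + τ * I : ℂ).re := fun τ => by rw [hre]; exact hσ0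
  have h5 : ((√Real.pi : ℝ) : ℂ) ≠ 0 :=
    ofReal_ne_zero.mpr (Real.sqrt_pos.mpr Real.pi_pos).ne'
  refine (integrable_Gamma_mul_Gamma hσ0 x).mul_bdd
    (c := 4 / √Real.pi * (2 ^ (2 * σ) / 8 * (Real.Gamma (σ + y) * Real.Gamma (σ - y)
      / Real.Gamma (σ + y + (σ - y))))) ?_ (Filter.Eventually.of_forall fun τ => ?_)
  · refine Continuous.aestronglyMeasurable ?_
    refine ((continuous_Gamma_comp (by fun_prop) h1).mul
      (continuous_Gamma_comp (by fun_prop) h2)).div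
      ((continuous_Gamma_comp (by fun_prop) h4).mul (continuous_Gamma_comp (by fun_prop) h3))
      fun τ => mul_ne_zero (Gamma_ne_zero_of_re_pos (h4 τ)) (Gamma_ne_zero_of_re_pos (h3 τ))
  · have h6 := two_cpow_mul_div_Gamma (h4 τ) (Gamma (σ + τ * I + y) * Gamma (σ + τ * I - y))
    have h7 := norm_Gamma_mul_Gamma_div_le (h1 τ) (h2 τ)
    rw [show (σ + τ * I + y + (σ + τ * I - y) : ℂ) = 2 * (σ + τ * I) by ring] at h7
    have e1 : (σ + τ * I + y : ℂ).re = σ + y := by rw [add_re, hre, ofReal_re]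
    have e2 : (σ + τ * I - y : ℂ).re = σ - y := by rw [sub_re, hre, ofReal_re]
    rw [e1, e2] at h7
    have h8 : Gamma (σ + τ * I + y) * Gamma (σ + τ * I - y)
        / (Gamma (σ + τ * I) * Gamma (σ + τ * I + 1 / 2))
        = 4 / (√Real.pi : ℝ) * (2 ^ (2 * (σ + τ * I) : ℂ) / 8
          * (Gamma (σ + τ * I + y) * Gamma (σ + τ * I - y) / Gamma (2 * (σ + τ * I)))) := by
      rw [h6]; field_simp
    rw [h8, norm_mul, norm_mul, norm_div, norm_div, norm_two_cpow_le, hre, Complex.norm_real,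
      Real.norm_of_nonneg (Real.sqrt_nonneg _), Complex.norm_ofNat, Complex.norm_ofNat]
    gcongr

/-- The Mellin–Barnes representation of `K_{y+ix}(b) K_{y-ix}(b)`. -/
theorem macdonaldK_mul_eq_mellinBarnes (x y : ℝ) {σ b : ℝ} (hσ : |y| < σ) (hb : 0 < b) :
    macdonaldK (y + I * x) b * macdonaldK (y - I * x) b
      = (√Real.pi : ℝ) / (4 * Real.pi)
        * ∫ τ : ℝ, macdonaldMellin x y (σ + τ * I) * (b : ℂ) ^ (-(2 * (σ + τ * I : ℂ))) := by
  set f : ℝ → ℂ := fun b => macdonaldK (y + I * x) b * macdonaldK (y - I * x) b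
  have hline : ∀ τ : ℝ, (((2 * σ : ℝ) : ℂ) + ((2 * τ : ℝ) : ℂ) * I) = 2 * (σ + τ * I) := fun τ => by
    push_cast; ring
  have hre : ∀ τ : ℝ, |y| < (σ + τ * I : ℂ).re := fun τ => by simpa
  have hconv : MellinConvergent f ((2 * σ : ℝ) : ℂ) := by
    have := (mellin_macdonaldK_mul x y (p := σ) (by simpa)).1
    rwa [show (2 * (σ : ℂ)) = ((2 * σ : ℝ) : ℂ) by push_cast; rfl] at this
  have hvert : VerticalIntegrable (mellin f) (2 * σ) := by
    have h1 := ((integrable_macdonaldMellin x y hσ).const_mul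
      ((√Real.pi : ℝ) / 4 : ℂ)).comp_mul_left' (R := 1 / 2) (by norm_num)
    refine h1.congr (Filter.Eventually.of_forall fun τ => ?_)
    simp only
    rw [← mellin_macdonaldK_mul_eq x y (hre _), ← hline]
    congr 2
    push_cast
    ring
  have hcont : ContinuousAt f b :=
    (continuousAt_macdonaldK _ hb).mul (continuousAt_macdonaldK _ hb)
  have h := mellinInv_mellin_eq (2 * σ) f hb hconv hvert hcont
  change f b = _
  rw [← h, mellinInv]
  -- The inversion variable is $2p$, so its line is $\operatorname{Re}=2\sigma$, and $\tau'=2\tau$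
  -- contributes a factor $2$.
  have hs := Measure.integral_comp_mul_left (fun τ' : ℝ => (b : ℂ) ^ (-(((2 * σ : ℝ) : ℂ) + τ' * I))
    • mellin f (((2 * σ : ℝ) : ℂ) + τ' * I)) 2
  have hs' : ∫ τ' : ℝ, (b : ℂ) ^ (-(((2 * σ : ℝ) : ℂ) + τ' * I))
      • mellin f (((2 * σ : ℝ) : ℂ) + τ' * I)
      = 2 * ∫ τ : ℝ, (√Real.pi : ℝ) / 4 * (macdonaldMellin x y (σ + τ * I)
          * (b : ℂ) ^ (-(2 * (σ + τ * I : ℂ)))) := by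
    have h3 : ∀ τ : ℝ, (b : ℂ) ^ (-(((2 * σ : ℝ) : ℂ) + ((2 * τ : ℝ) : ℂ) * I))
        • mellin f (((2 * σ : ℝ) : ℂ) + ((2 * τ : ℝ) : ℂ) * I) = (√Real.pi : ℝ) / 4
          * (macdonaldMellin x y (σ + τ * I) * (b : ℂ) ^ (-(2 * (σ + τ * I : ℂ)))) := fun τ => by
      rw [hline, mellin_macdonaldK_mul_eq x y (hre τ), smul_eq_mul]
      ring
    simp only [h3] at hs
    rw [hs, abs_of_pos (by norm_num), real_smul]
    push_cast
    ring
  rw [hs', integral_const_mul, real_smul]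
  generalize ∫ τ : ℝ, macdonaldMellin x y (σ + τ * I) * (b : ℂ) ^ (-(2 * (σ + τ * I : ℂ))) = J
  have hpi : (Real.pi : ℂ) ≠ 0 := ofReal_ne_zero.mpr Real.pi_ne_zero
  push_cast
  field_simp

theorem macdonaldMellin_zero (x : ℝ) {p : ℂ} (hp : 0 < p.re) :
    macdonaldMellin x 0 p
      = Gamma (p + I * x) * Gamma (p - I * x) * (Gamma p / Gamma (p + 1 / 2)) := by
  have := Gamma_ne_zero_of_re_pos hp
  rw [macdonaldMellin, ofReal_zero, add_zero, sub_zero, mul_div_mul_left _ _ this]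

theorem macdonaldKix_sq_eq_mellinBarnes (x : ℝ) {σ b : ℝ} (hσ : 0 < σ) (hb : 0 < b) :
    (macdonaldKix x b : ℂ) ^ 2
      = (√Real.pi : ℝ) / (4 * Real.pi)
        * ∫ τ : ℝ, macdonaldMellin x 0 (σ + τ * I) * (b : ℂ) ^ (-(2 * (σ + τ * I : ℂ))) := by
  rw [← macdonaldK_mul_eq_mellinBarnes x 0 (by simpa) hb, ofReal_zero, zero_add, zero_sub,
    macdonaldK_neg, macdonaldK_I_mul_ofReal, sq]

/-! ### Barnes integrals as beta-weighted integrals -/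

/-- With $s=-p$, all dependence on $y$ and $k$ sits in one beta quotient multiplying the integrand
for $K_{ix}(a)^2$. -/
theorem barnesIntegrand_neg (a x y : ℝ) (k : ℕ) {p : ℂ} (hp : 0 < p.re) :
    barnesIntegrand a x y k (-p) = macdonaldMellin x 0 p * (a : ℂ) ^ (-(2 * p))
      * (Gamma (p + y) / Gamma (p + y + (k + 1 : ℝ))) := by
  rw [macdonaldMellin_zero x hp, barnesIntegrand]
  rw [show I * x - -p = p + I * x by ring, show -(I * x) - -p = p - I * x by ring,
    show (y : ℂ) - -p = p + y by ring, neg_neg, show (1 / 2 : ℂ) - -p = p + 1 / 2 by ring,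
    show (y + k + 1 - -p : ℂ) = p + y + (k + 1 : ℝ) by push_cast; ring, mul_neg]
  simp only [div_eq_mul_inv, mul_inv]
  ring

theorem norm_cpow_neg_line {a : ℝ} (ha : 0 < a) (σ τ : ℝ) :
    ‖(a : ℂ) ^ (-(2 * (σ + τ * I : ℂ)))‖ = a ^ (-(2 * σ)) := by
  rw [norm_cpow_eq_rpow_re_of_pos ha]
  simp

theorem continuous_cpow_neg_line {a : ℝ} (ha : 0 < a) (σ : ℝ) :
    Continuous (fun τ : ℝ => (a : ℂ) ^ (-(2 * (σ + τ * I : ℂ)))) := by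
  refine Continuous.const_cpow (by fun_prop) (Or.inl (ofReal_ne_zero.mpr ha.ne'))

theorem integrable_macdonaldMellin_mul_cpow (x y : ℝ) {σ a : ℝ} (hσ : |y| < σ) (ha : 0 < a) :
    Integrable (fun τ : ℝ => macdonaldMellin x y (σ + τ * I)
      * (a : ℂ) ^ (-(2 * (σ + τ * I : ℂ)))) :=
  (integrable_macdonaldMellin x y hσ).mul_bdd (c := a ^ (-(2 * σ)))
    (continuous_cpow_neg_line ha σ).aestronglyMeasurable
    (Filter.Eventually.of_forall fun τ => (norm_cpow_neg_line ha σ τ).le)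

theorem norm_barnesIntegrand_le (a x : ℝ) {y σ : ℝ} (hσ : 0 < σ) (hσy : 0 < σ + y)
    (k : ℕ) (τ : ℝ) :
    ‖barnesIntegrand a x y k (-(σ + τ * I))‖
      ≤ ‖macdonaldMellin x 0 (σ + τ * I) * (a : ℂ) ^ (-(2 * (σ + τ * I : ℂ)))‖
        * (Real.Gamma (σ + y) / Real.Gamma (σ + y + (k + 1))) := by
  rw [barnesIntegrand_neg a x y k (by simpa), norm_mul]
  refine mul_le_mul_of_nonneg_left ?_ (norm_nonneg _)
  have h := norm_Gamma_div_Gamma_add_le (u := σ + τ * I + y) (by simpa) (δ := k + 1)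
    (by positivity)
  have e : (σ + τ * I + y : ℂ).re = σ + y := by simp
  rwa [e] at h

theorem integrable_barnesIntegrand {a x y σ : ℝ} (ha : 0 < a) (hσ : 0 < σ) (hσy : 0 < σ + y)
    (k : ℕ) : Integrable (fun τ : ℝ => barnesIntegrand a x y k (-(σ + τ * I))) := by
  have h0 := integrable_macdonaldMellin_mul_cpow x 0 (σ := σ) (by simpa) ha
  have h := h0.mul_bdd (c := Real.Gamma (σ + y) / Real.Gamma (σ + y + (k + 1)))
    (g := fun τ : ℝ => Gamma (σ + τ * I + y) / Gamma (σ + τ * I + y + (k + 1 : ℝ))) ?_ ?_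
  · exact h.congr (Filter.Eventually.of_forall fun τ => (barnesIntegrand_neg a x y k (by simpa)).symm)
  · have h1 : ∀ τ : ℝ, 0 < (σ + τ * I + y + (k + 1 : ℝ) : ℂ).re := fun τ => by
      simp; positivity
    exact ((continuous_Gamma_comp (by fun_prop) fun τ => by simpa).div
      (continuous_Gamma_comp (by fun_prop) h1)
      fun τ => Gamma_ne_zero_of_re_pos (h1 τ)).aestronglyMeasurable
  · refine Filter.Eventually.of_forall fun τ => ?_
    have h := norm_Gamma_div_Gamma_add_le (u := σ + τ * I + y) (by simpa) (δ := k + 1)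
      (by positivity)
    have e : (σ + τ * I + y : ℂ).re = σ + y := by simp
    rwa [e] at h

theorem macdonaldKix_sq_div_sqrt {a x σ t : ℝ} (ha : 0 < a) (hσ : 0 < σ) (ht : 0 < t) :
    (macdonaldKix x (a / √t) : ℂ) ^ 2 = (√Real.pi : ℝ) / (4 * Real.pi)
      * ∫ τ : ℝ, macdonaldMellin x 0 (σ + τ * I) * (a : ℂ) ^ (-(2 * (σ + τ * I : ℂ)))
        * (t : ℂ) ^ (σ + τ * I : ℂ) := by
  have hst := Real.sqrt_pos.mpr ht
  rw [macdonaldKix_sq_eq_mellinBarnes x hσ (div_pos ha hst)]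
  congr 1
  refine integral_congr_ae (Filter.Eventually.of_forall fun τ => ?_)
  simp only
  rw [mul_assoc, ofReal_cpow_eq_exp (div_pos ha hst), ofReal_cpow_eq_exp ha, ofReal_cpow_eq_exp ht,
    ← Complex.exp_add, Real.log_div ha.ne' hst.ne', Real.log_sqrt ht.le]
  congr 2
  push_cast
  ring

theorem betaIntegrand_nonneg (a x y : ℝ) (k : ℕ) {t : ℝ} (ht : t ∈ Ioo (0 : ℝ) 1) :
    0 ≤ betaIntegrand a x y k t := by
  have h1 := Real.rpow_nonneg ht.1.le (y - 1)
  have h2 : 0 ≤ 1 - t := sub_nonneg.mpr ht.2.le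
  unfold betaIntegrand
  positivity

/-- The contour integral is the integral of `betaIntegrand`. -/
theorem integrableOn_and_integral_betaIntegrand {a x y σ : ℝ} (ha : 0 < a) (hσ : 0 < σ)
    (hσy : 0 < σ + y) (k : ℕ) :
    IntegrableOn (betaIntegrand a x y k) (Ioo 0 1) ∧
    ((∫ t in Ioo (0 : ℝ) 1, betaIntegrand a x y k t : ℝ) : ℂ)
      = (√Real.pi : ℝ) / (4 * Real.pi) * k.factorial
        * ∫ τ : ℝ, barnesIntegrand a x y k (-(σ + τ * I)) := by
  set g : ℝ → ℂ := fun τ => macdonaldMellin x 0 (σ + τ * I) * (a : ℂ) ^ (-(2 * (σ + τ * I : ℂ)))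
    with hg
  have hgi : Integrable g := integrable_macdonaldMellin_mul_cpow x 0 (σ := σ) (by simpa) ha
  set h : ℝ × ℝ → ℂ := fun z => (z.1 : ℂ) ^ (σ + z.2 * I + y - 1 : ℂ)
    * (1 - (z.1 : ℂ)) ^ ((k + 1 : ℝ) - 1 : ℂ) with hh
  have hrp : ∀ τ : ℝ, (σ + τ * I + y : ℂ).re = σ + y := fun τ => by simp
  have hk1 : (0 : ℝ) < k + 1 := by positivity
  have hΦ : Integrable (fun z : ℝ × ℝ => h z * g z.2)
      ((volume.restrict (Ioo (0 : ℝ) 1)).prod volume) := by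
    have h1 := (integrableOn_rpow_mul_one_sub_rpow hσy hk1).mul_prod hgi.norm
    have hm : Measurable h := by
      simp only [hh]
      fun_prop
    refine h1.mono' (hm.aestronglyMeasurable.mul hgi.aestronglyMeasurable.comp_snd) ?_
    have h2 : ∀ᵐ z : ℝ × ℝ ∂((volume.restrict (Ioo (0 : ℝ) 1)).prod volume), z.1 ∈ Ioo (0 : ℝ) 1 :=
      Measure.quasiMeasurePreserving_fst.ae (ae_restrict_mem measurableSet_Ioo)
    filter_upwards [h2] with z hz
    have h3 := norm_cpow_mul_one_sub_cpow (σ + z.2 * I + y) ((k + 1 : ℝ) : ℂ) hz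
    rw [hrp, ofReal_re] at h3
    rw [norm_mul, h3]
  have hcongr : ∀ t ∈ Ioo (0 : ℝ) 1, ((betaIntegrand a x y k t : ℝ) : ℂ)
      = (√Real.pi : ℝ) / (4 * Real.pi) * ∫ τ : ℝ, h (t, τ) * g τ := by
    intro t ht
    have ht0 : (t : ℂ) ≠ 0 := ofReal_ne_zero.mpr ht.1.ne'
    have e1 : ∀ τ : ℝ, h (t, τ) * g τ = (t : ℂ) ^ (y - 1 : ℂ) * (1 - (t : ℂ)) ^ k
        * (g τ * (t : ℂ) ^ (σ + τ * I : ℂ)) := fun τ => by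
      simp only [hh]
      rw [show (σ + τ * I + y - 1 : ℂ) = (y - 1) + (σ + τ * I) by ring, cpow_add _ _ ht0,
        show (((k : ℝ) + 1 : ℝ) - 1 : ℂ) = (k : ℂ) by push_cast; ring, cpow_natCast]
      ring
    simp only [e1]
    rw [integral_const_mul, betaIntegrand, ofReal_mul, ofReal_pow, macdonaldKix_sq_div_sqrt ha hσ ht.1,
      ofReal_mul, ofReal_cpow ht.1.le]
    push_cast
    ring
  refine ⟨?_, ?_⟩
  · have h1 := (hΦ.integral_prod_left.const_mul ((√Real.pi : ℝ) / (4 * Real.pi) : ℂ))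
    have h2 : IntegrableOn (fun t => ((betaIntegrand a x y k t : ℝ) : ℂ)) (Ioo 0 1) :=
      (integrableOn_congr_fun hcongr measurableSet_Ioo).mpr h1
    exact h2.re
  · refine (integral_ofReal (𝕜 := ℂ)).symm.trans
      ((setIntegral_congr_fun measurableSet_Ioo hcongr).trans ?_)
    rw [integral_const_mul, mul_assoc, integral_integral_swap hΦ,
      ← integral_const_mul (k.factorial : ℂ)]
    congr 1
    refine integral_congr_ae (Filter.Eventually.of_forall fun τ => ?_)
    simp only
    rw [integral_mul_const, barnesIntegrand_neg a x y k (by simpa)]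
    -- The inner integral over $t$ is a beta integral with second argument $k+1$; its $\Gamma(k+1)$
    -- is the factor $k!$.
    have h1 := integral_cpow_mul_one_sub_cpow (u := σ + τ * I + y) (v := ((k + 1 : ℝ) : ℂ))
      (by rwa [hrp]) (by rwa [ofReal_re])
    have h2 : Gamma ((k + 1 : ℝ) : ℂ) = k.factorial := by
      push_cast
      exact Gamma_nat_eq_factorial k
    rw [h2] at h1
    simp only [hh, hg]
    rw [h1]
    ring

/-! ### Summation of the Barnes series -/

theorem Real.ascPochhammer_eval_mul_Gamma {r : ℝ} (hr : 0 < r) (n : ℕ) :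
    (ascPochhammer ℝ n).eval r * Real.Gamma r = Real.Gamma (r + n) := by
  induction n with
  | zero => simp
  | succ n ih =>
    have : r + n ≠ 0 := by positivity
    rw [Nat.cast_succ, ← add_assoc, Real.Gamma_add_one this, ← ih, ascPochhammer_succ_eval]
    ring

theorem Complex.ascPochhammer_eval_mul_Gamma {z : ℂ} (hz : 0 < z.re) (n : ℕ) :
    (ascPochhammer ℂ n).eval z * Gamma z = Gamma (z + n) := by
  rw [← Gamma_add_nat_div_Gamma_eq, div_mul_cancel₀ _ (Gamma_ne_zero_of_re_pos hz)]
  intro m hm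
  rw [hm, neg_re, natCast_re] at hz
  have : (0 : ℝ) ≤ m := m.cast_nonneg
  linarith

theorem gaussTermReal_eq_Gamma_div (y : ℝ) {r : ℝ} (hr : 0 < r) (k : ℕ) :
    gaussTermReal y r k = (ascPochhammer ℝ k).eval (y + 1) ^ 2 / (k + 1).factorial
      * (Real.Gamma r / Real.Gamma (r + (k + 1))) := by
  have h := Real.ascPochhammer_eval_mul_Gamma hr (k + 1)
  have h1 := (Real.Gamma_pos_of_pos hr).ne'
  have h2 := (ascPochhammer_pos (k + 1) r hr).ne'
  push_cast at h
  rw [gaussTermReal, ← h]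
  field_simp

theorem gaussTerm_eq_Gamma_div (y : ℝ) {z : ℂ} (hz : 0 < z.re) (k : ℕ) :
    gaussTerm y z k = (((ascPochhammer ℝ k).eval (y + 1) ^ 2 / ((k + 1).factorial : ℝ) : ℝ) : ℂ)
      * (Gamma z / Gamma (z + (k + 1 : ℝ))) := by
  have h := Complex.ascPochhammer_eval_mul_Gamma hz (k + 1)
  have h1 := Gamma_ne_zero_of_re_pos hz
  have h2 := ascPochhammer_eval_ne_zero_of_re_pos hz (k + 1)
  push_cast at h ⊢
  rw [gaussTerm, ← h]
  field_simp

/-- The factor $i$ from $ds=i\,d\tau$ cancels the one in $4\pi i$, and $\tau\mapsto-\tau$ puts the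
line in the form $s=-p$. -/
theorem barnesTerm_eq (a x y c : ℝ) (k : ℕ) :
    barnesTerm a x y c k = (√Real.pi : ℝ) / (4 * Real.pi)
      * ∫ τ : ℝ, (((ascPochhammer ℝ k).eval (y + 1) ^ 2 / ((k + 1).factorial : ℝ) : ℝ) : ℂ)
        * barnesIntegrand a x y k (-(((-c : ℝ) : ℂ) + τ * I)) := by
  have hpi : (Real.pi : ℂ) ≠ 0 := ofReal_ne_zero.mpr Real.pi_ne_zero
  rw [integral_const_mul, barnesTerm, verticalIntegral,
    ← integral_neg_eq_self (fun τ : ℝ => barnesIntegrand a x y k (c + τ * I))]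
  have e : ∀ τ : ℝ, (c + ((-τ : ℝ) : ℂ) * I : ℂ) = -(((-c : ℝ) : ℂ) + τ * I) := fun τ => by
    push_cast; ring
  simp only [e]
  generalize ∫ τ : ℝ, barnesIntegrand a x y k (-(((-c : ℝ) : ℂ) + τ * I)) = J
  field_simp

/-- Summation of the Mellin–Barnes series by Gauss's theorem. -/
theorem summable_barnesTerm_and_mul_tsum {a x y c : ℝ} (ha : 0 < a) (hc : c < -|y|) :
    Summable (barnesTerm a x y c) ∧
    (y : ℂ) ^ 2 * barnesL a x y c
      = macdonaldK (y + I * x) a * macdonaldK (y - I * x) a - (macdonaldKix x a : ℂ) ^ 2 := by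
  obtain ⟨σ, rfl⟩ : ∃ σ : ℝ, c = -σ := ⟨-c, (neg_neg c).symm⟩
  have hσ : |y| < σ := by linarith
  have hσ0 : 0 < σ := (abs_nonneg y).trans_lt hσ
  have hy := abs_lt.mp hσ
  have hr : 0 < σ + y := by linarith
  set g : ℝ → ℂ := fun τ => macdonaldMellin x 0 (σ + τ * I) * (a : ℂ) ^ (-(2 * (σ + τ * I : ℂ)))
  have hgi : Integrable g := integrable_macdonaldMellin_mul_cpow x 0 (σ := σ) (by simpa) ha
  set F : ℕ → ℝ → ℂ := fun k τ =>
    (((ascPochhammer ℝ k).eval (y + 1) ^ 2 / ((k + 1).factorial : ℝ) : ℝ) : ℂ)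
      * barnesIntegrand a x y k (-(σ + τ * I)) with hF
  have hFi : ∀ k, Integrable (F k) := fun k =>
    (integrable_barnesIntegrand ha hσ0 hr k).const_mul _
  have hFn : ∀ k τ, ‖F k τ‖ ≤ gaussTermReal y (σ + y) k * ‖g τ‖ := fun k τ => by
    have h := norm_barnesIntegrand_le a x hσ0 hr k τ
    simp only [hF]
    rw [norm_mul, Complex.norm_real, Real.norm_of_nonneg (by positivity),
      gaussTermReal_eq_Gamma_div y hr, mul_assoc, mul_comm (_ / _) ‖g τ‖]
    exact mul_le_mul_of_nonneg_left h (by positivity)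
  -- The $L^1$ norms are dominated by the Gauss series with parameter $\sigma+y$, convergent because
  -- $\sigma+y>2y$.
  have hFs : Summable fun k => ∫ τ, ‖F k τ‖ := by
    refine Summable.of_nonneg_of_le (fun k => integral_nonneg fun τ => norm_nonneg _) (fun k => ?_)
      ((summable_gaussTermReal y hr (by linarith)).mul_right (∫ τ, ‖g τ‖))
    rw [← integral_const_mul]
    exact integral_mono (hFi k).norm (hgi.norm.const_mul _) (hFn k)
  have hsum := (hasSum_integral_of_summable_integral_norm hFi hFs).mul_left
    ((√Real.pi : ℝ) / (4 * Real.pi) : ℂ)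
  have hterm : ∀ k, ((√Real.pi : ℝ) / (4 * Real.pi) : ℂ) * ∫ τ, F k τ
      = barnesTerm a x y (-σ) k := fun k => by
    rw [barnesTerm_eq, neg_neg]
  simp only [hterm] at hsum
  refine ⟨hsum.summable, ?_⟩
  rw [barnesL, hsum.tsum_eq, macdonaldK_mul_eq_mellinBarnes x y hσ ha,
    macdonaldKix_sq_eq_mellinBarnes x hσ0 ha, ← mul_sub,
    ← integral_sub (integrable_macdonaldMellin_mul_cpow x y hσ ha) hgi, mul_left_comm,
    ← integral_const_mul]
  congr 1
  refine integral_congr_ae (Filter.Eventually.of_forall fun τ => ?_)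
  have hre : (σ + τ * I : ℂ).re = σ := by simp
  have hp : 0 < (σ + τ * I : ℂ).re := by rwa [hre]
  have hpy : (σ + τ * I + y : ℂ).re = σ + y := by rw [add_re, hre, ofReal_re]
  have hFk : ∀ k, F k τ = g τ * gaussTerm y (σ + τ * I + y) k := fun k => by
    simp only [hF, g]
    rw [barnesIntegrand_neg a x y k hp, gaussTerm_eq_Gamma_div y (by rwa [hpy])]
    ring
  -- Gauss's theorem at $c=p+y$, so that $c-2y=p-y$ and $c-y=p$.
  have hG := one_add_tsum_gaussTerm y (c := σ + τ * I + y) (by rwa [hpy]) (by rw [hpy]; linarith)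
  rw [show (σ + τ * I + y - 2 * y : ℂ) = σ + τ * I - y by ring, add_sub_cancel_right] at hG
  simp only [hFk, tsum_mul_left]
  rw [mul_left_comm, eq_sub_of_add_eq' hG]
  simp only [g]
  rw [macdonaldMellin_zero x hp, macdonaldMellin]
  have h0 := Gamma_ne_zero_of_re_pos hp
  have h1 : Gamma (σ + τ * I + 1 / 2) ≠ 0 :=
    Gamma_ne_zero_of_re_pos (by rw [add_re, hre]; norm_num; linarith)
  generalize (a : ℂ) ^ (-(2 * (σ + τ * I : ℂ))) = A
  field_simp

theorem barnesTerm_eq_integral_betaIntegrand {a x y c : ℝ} (ha : 0 < a) (hc : c < -|y|) (k : ℕ) :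
    barnesTerm a x y c k = (((ascPochhammer ℝ k).eval (y + 1) ^ 2
      / ((k.factorial : ℝ) * ((k + 1).factorial : ℝ))
        * ∫ t in Ioo (0 : ℝ) 1, betaIntegrand a x y k t : ℝ) : ℂ) := by
  have hy := neg_abs_le y
  have hy0 := abs_nonneg y
  rw [ofReal_mul, (integrableOn_and_integral_betaIntegrand ha (σ := -c) (x := x) (y := y)
    (by linarith) (by linarith) k).2, barnesTerm_eq, integral_const_mul]
  have h1 : (k.factorial : ℂ) ≠ 0 := Nat.cast_ne_zero.mpr (Nat.factorial_ne_zero _)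
  generalize ∫ τ : ℝ, barnesIntegrand a x y k (-(((-c : ℝ) : ℂ) + τ * I)) = J
  push_cast
  field_simp

/-! ### Strict positivity of the integrals -/

theorem macdonaldKix_eq_integral {b : ℝ} (x : ℝ) :
    macdonaldKix x b = ∫ u in Ioi (0 : ℝ), Real.exp (-b * Real.cosh u) * Real.cos (x * u) := by
  rw [← ofReal_inj, ← macdonaldK_I_mul_ofReal, macdonaldK]
  refine Eq.trans ?_ (integral_ofReal (𝕜 := ℂ))
  refine integral_congr_ae (Filter.Eventually.of_forall fun u => ?_)
  have : Complex.cosh (I * x * u) = ((Real.cos (x * u) : ℝ) : ℂ) := by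
    rw [show I * x * u = ((x * u : ℝ) : ℂ) * I by push_cast; ring, Complex.cosh_mul_I, ofReal_cos]
  simp [this]

/-- `K_{ix}(b)` is positive for all large `b`. -/
theorem exists_forall_macdonaldKix_pos (x : ℝ) : ∃ B > 0, ∀ b ≥ B, 0 < macdonaldKix x b := by
  -- Chosen so that $|xu|\le1$ on $[0,\delta]$, whence $\cos(xu)\ge\frac12$ there.
  set δ : ℝ := 1 / (|x| + 1) with hδ
  have hx0 := abs_nonneg x
  have hδ0 : 0 < δ := by positivity
  have hcos : ∀ u : ℝ, 0 ≤ u → u ≤ δ → 1 / 2 ≤ Real.cos (x * u) := by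
    intro u hu0 hu
    have h1 : |x * u| ≤ 1 := by
      rw [abs_mul, abs_of_nonneg hu0]
      calc |x| * u ≤ (|x| + 1) * δ := by gcongr; linarith
        _ = 1 := by rw [hδ]; field_simp
    have h2 : (x * u) ^ 2 ≤ 1 := by rw [← sq_abs]; exact pow_le_one₀ (abs_nonneg _) h1
    have h3 := Real.one_sub_sq_div_two_le_cos (x := x * u)
    linarith
  have hm : Real.cosh (δ / 2) < Real.cosh δ := by
    rw [Real.cosh_lt_cosh, abs_of_pos hδ0, abs_of_pos (half_pos hδ0)]
    linarith
  have hint : ∀ b : ℝ, 0 < b → Integrable (fun u : ℝ => Real.exp (-b * Real.cosh u)) := by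
    intro b hb
    simpa using integrable_exp_neg_cosh_mul_exp hb 0
  set C : ℝ := ∫ u in Ioi (0 : ℝ), Real.exp (Real.cosh δ) * Real.exp (-1 * Real.cosh u) with hC
  have hlim : Filter.Tendsto (fun b : ℝ => δ / 4 * Real.exp (b * (Real.cosh δ - Real.cosh (δ / 2))))
      Filter.atTop Filter.atTop :=
    (Real.tendsto_exp_atTop.comp (Filter.tendsto_id.atTop_mul_const (sub_pos.mpr hm))).const_mul_atTop
      (by positivity)
  obtain ⟨B, hB⟩ := (hlim.eventually (Filter.eventually_gt_atTop C)).exists_forall_of_atTop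
  refine ⟨max B 1, by positivity, fun b hb => ?_⟩
  have hb1 : 1 ≤ b := (le_max_right _ _).trans hb
  have hb0 : 0 < b := by linarith
  have hCb := hB b ((le_max_left _ _).trans hb)
  have hi : Integrable (fun u : ℝ => Real.exp (b * Real.cosh δ)
      * (Real.exp (-b * Real.cosh u) * Real.cos (x * u))) := by
    refine Integrable.const_mul ?_ _
    refine (hint b hb0).mul_bdd (c := 1) (by fun_prop) (Filter.Eventually.of_forall fun u => ?_)
    exact Real.abs_cos_le_one _
  have hl : Integrable ((Ioo (0 : ℝ) (δ / 2)).indicator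
      fun _ => 1 / 2 * Real.exp (b * (Real.cosh δ - Real.cosh (δ / 2)))) := by
    rw [integrable_indicator_iff measurableSet_Ioo]
    exact integrableOn_const (by simp)
  -- After scaling by $e^{b\cosh\delta}$, the range $u<\delta/2$ contributes exponential growth in
  -- $b$, $[\delta/2,\delta]$ is nonnegative, and for $b\ge1$ the oscillating tail costs at most the
  -- fixed amount $C$.
  have hle : ∀ u ∈ Ioi (0 : ℝ), (Ioo (0 : ℝ) (δ / 2)).indicator
      (fun _ => 1 / 2 * Real.exp (b * (Real.cosh δ - Real.cosh (δ / 2)))) u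
      - Real.exp (Real.cosh δ) * Real.exp (-1 * Real.cosh u)
      ≤ Real.exp (b * Real.cosh δ) * (Real.exp (-b * Real.cosh u) * Real.cos (x * u)) := by
    intro u hu
    have hu0 : 0 < u := hu
    rw [← mul_assoc, ← Real.exp_add, ← Real.exp_add]
    have hpos := Real.exp_pos (b * Real.cosh δ + -b * Real.cosh u)
    have hpos' := Real.exp_pos (Real.cosh δ + -1 * Real.cosh u)
    by_cases h1 : u < δ / 2
    · rw [indicator_of_mem (show u ∈ Ioo (0 : ℝ) (δ / 2) from ⟨hu0, h1⟩)]
      have h2 := hcos u hu0.le (by linarith)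
      have h3 : Real.cosh u ≤ Real.cosh (δ / 2) := by
        rw [Real.cosh_le_cosh, abs_of_pos hu0, abs_of_pos (half_pos hδ0)]; exact h1.le
      have h4 : Real.exp (b * (Real.cosh δ - Real.cosh (δ / 2)))
          ≤ Real.exp (b * Real.cosh δ + -b * Real.cosh u) := by
        have := mul_le_mul_of_nonneg_left h3 hb0.le
        exact Real.exp_le_exp.mpr (by linarith)
      have := mul_le_mul_of_nonneg_left h2 hpos.le
      linarith
    · rw [indicator_of_notMem (fun h => h1 h.2), zero_sub]
      by_cases h2 : u ≤ δ
      · have := mul_nonneg hpos.le (one_half_pos.le.trans (hcos u hu0.le h2))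
        linarith
      · have h3 : Real.cosh δ ≤ Real.cosh u := by
          rw [Real.cosh_le_cosh, abs_of_pos hu0, abs_of_pos hδ0]; exact (not_le.mp h2).le
        have h4 : Real.exp (b * Real.cosh δ + -b * Real.cosh u)
            ≤ Real.exp (Real.cosh δ + -1 * Real.cosh u) := by
          have := mul_le_mul_of_nonneg_right hb1 (sub_nonneg.mpr h3)
          exact Real.exp_le_exp.mpr (by linarith)
        have := mul_le_mul_of_nonneg_left (Real.neg_one_le_cos (x * u)) hpos.le
        linarith
  have hCi := (hint 1 one_pos).const_mul (Real.exp (Real.cosh δ))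
  have hmono := setIntegral_mono_on (hl.sub hCi).integrableOn hi.integrableOn measurableSet_Ioi hle
  simp only [Pi.sub_apply] at hmono
  rw [integral_sub hl.integrableOn hCi.integrableOn, integral_const_mul _ (fun u : ℝ =>
    Real.exp (-b * Real.cosh u) * Real.cos (x * u)), ← macdonaldKix_eq_integral, ← hC,
    setIntegral_indicator measurableSet_Ioo,
    inter_eq_self_of_subset_right
      (Ioo_subset_Ioi_self : Ioo (0 : ℝ) (δ / 2) ⊆ Ioi 0),
    setIntegral_const, Real.volume_real_Ioo_of_le (half_pos hδ0).le, smul_eq_mul] at hmono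
  have hfin : 0 < Real.exp (b * Real.cosh δ) * macdonaldKix x b := by linarith
  exact pos_of_mul_pos_right hfin (Real.exp_pos _).le

/-- As $t\to0$ the argument $a/\sqrt t$ tends to infinity, where $K_{ix}$ is positive; $t<(a/B)^2$
means $a/\sqrt t>B$. -/
theorem integral_betaIntegrand_pos {a x y : ℝ} (ha : 0 < a) {k : ℕ}
    (hi : IntegrableOn (betaIntegrand a x y k) (Ioo 0 1)) :
    0 < ∫ t in Ioo (0 : ℝ) 1, betaIntegrand a x y k t := by
  obtain ⟨B, hB0, hB⟩ := exists_forall_macdonaldKix_pos x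
  have hnn : 0 ≤ᵐ[volume.restrict (Ioo (0 : ℝ) 1)] betaIntegrand a x y k := by
    filter_upwards [ae_restrict_mem measurableSet_Ioo] with t ht
    exact betaIntegrand_nonneg a x y k ht
  rw [setIntegral_pos_iff_support_of_nonneg_ae hnn hi]
  have hm : 0 < min 1 ((a / B) ^ 2) := by positivity
  refine lt_of_lt_of_le (b := volume (Ioo 0 (min 1 ((a / B) ^ 2)))) (by simpa using hm)
    (measure_mono fun t ht => ?_)
  have ht1 : t < 1 := ht.2.trans_le (min_le_left _ _)
  have ht2 : t < (a / B) ^ 2 := ht.2.trans_le (min_le_right _ _)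
  have hst : 0 < √t := Real.sqrt_pos.mpr ht.1
  have hK : 0 < macdonaldKix x (a / √t) := by
    refine hB _ ?_
    have h1 : √t ≤ a / B := (Real.sqrt_le_sqrt ht2.le).trans (Real.sqrt_sq (by positivity)).le
    rw [ge_iff_le, le_div_iff₀ hst]
    rw [le_div_iff₀ hB0] at h1
    linarith
  refine ⟨?_, ht.1, ht1⟩
  have h1 := Real.rpow_pos_of_pos ht.1 (y - 1)
  have h2 : 0 < 1 - t := sub_pos.mpr ht1
  rw [Function.mem_support, betaIntegrand]
  positivity

/-! ### The hypergeometric integral and the conclusion -/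

/-- Rests on $(2)_k=(k+1)!$. No restriction on $t$ is needed, since `tsum` over a field commutes
with scalars even without convergence. -/
theorem hyperIntegrand_eq_tsum (a x y t : ℝ) :
    hyperIntegrand a x y t = ∑' k : ℕ, (ascPochhammer ℝ k).eval (y + 1) ^ 2
      / ((k.factorial : ℝ) * ((k + 1).factorial : ℝ)) * betaIntegrand a x y k t := by
  have h2 : ∀ k : ℕ, (ascPochhammer ℝ k).eval (2 : ℝ) = ((k + 1).factorial : ℝ) := fun k => by
    induction k with
    | zero => simp
    | succ k ih =>
      rw [ascPochhammer_succ_eval, ih, Nat.factorial_succ (k + 1)]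
      push_cast
      ring
  rw [hyperIntegrand, ordinaryHypergeometric_eq_tsum]
  simp only
  rw [← tsum_mul_left, ← tsum_mul_right]
  refine tsum_congr fun k => ?_
  have h3 := h2 k
  rw [h3, betaIntegrand, smul_eq_mul]
  have : ((k + 1).factorial : ℝ) ≠ 0 := by positivity
  field_simp

theorem barnesL_series {a x y c : ℝ} (ha : 0 < a) (hc : c < -|y|) :
    (barnesL a x y c).im = 0 ∧ 0 < (barnesL a x y c).re ∧
    HasSum (fun k : ℕ => ((ascPochhammer ℝ k).eval (y + 1)) ^ 2
        / ((k.factorial : ℝ) * ((k + 1).factorial : ℝ))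
          * ∫ t in Ioo (0 : ℝ) 1, betaIntegrand a x y k t)
      (barnesL a x y c).re := by
  have hy := neg_abs_le y
  have hy0 := abs_nonneg y
  have hL := (summable_barnesTerm_and_mul_tsum (x := x) ha hc).1.hasSum
  have hpos : ∀ k, 0 < ∫ t in Ioo (0 : ℝ) 1, betaIntegrand a x y k t := fun k =>
    integral_betaIntegrand_pos ha (integrableOn_and_integral_betaIntegrand ha (σ := -c)
      (by linarith) (by linarith) k).1
  have hterm := barnesTerm_eq_integral_betaIntegrand (x := x) ha hc
  have hre := hasSum_re hL
  have him := hasSum_im hL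
  simp only [hterm, ofReal_re, ofReal_im] at hre him
  have hL' : (∑' k, barnesTerm a x y c k) = barnesL a x y c := rfl
  simp only [← hterm, hL'] at hre him
  refine ⟨(hasSum_zero.unique him).symm, ?_, hre⟩
  rw [← hre.tsum_eq]
  -- Strictness comes from $k=0$, whose coefficient is $1$; later coefficients vanish when $y=-1$,
  -- for instance.
  refine hre.summable.tsum_pos (fun k => ?_) 0 ?_
  · exact mul_nonneg (by positivity) (hpos k).le
  · simpa using hpos 0

theorem hyperIntegrand_nonneg (a x y : ℝ) {t : ℝ} (ht : t ∈ Ioo (0 : ℝ) 1) :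
    0 ≤ hyperIntegrand a x y t := by
  rw [hyperIntegrand_eq_tsum]
  exact tsum_nonneg fun k => mul_nonneg (by positivity) (betaIntegrand_nonneg a x y k ht)

theorem integrableOn_and_integral_hyperIntegrand {a x y c : ℝ} (ha : 0 < a) (hc : c < -|y|) :
    IntegrableOn (hyperIntegrand a x y) (Ioo 0 1) ∧
    ∫ t in Ioo (0 : ℝ) 1, hyperIntegrand a x y t = (barnesL a x y c).re := by
  have hy := neg_abs_le y
  have hy0 := abs_nonneg y
  obtain ⟨-, hpos, hsum⟩ := barnesL_series (x := x) ha hc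
  have hnorm : ∀ k : ℕ, ∫ t in Ioo (0 : ℝ) 1, ‖(ascPochhammer ℝ k).eval (y + 1) ^ 2
        / ((k.factorial : ℝ) * ((k + 1).factorial : ℝ)) * betaIntegrand a x y k t‖
      = (ascPochhammer ℝ k).eval (y + 1) ^ 2 / ((k.factorial : ℝ) * ((k + 1).factorial : ℝ))
        * ∫ t in Ioo (0 : ℝ) 1, betaIntegrand a x y k t := fun k => by
    rw [← integral_const_mul]
    refine setIntegral_congr_fun measurableSet_Ioo fun t ht => ?_
    exact Real.norm_of_nonneg (mul_nonneg (by positivity) (betaIntegrand_nonneg a x y k ht))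
  have h := hasSum_integral_of_summable_integral_norm
    (μ := volume.restrict (Ioo (0 : ℝ) 1))
    (F := fun (k : ℕ) t => (ascPochhammer ℝ k).eval (y + 1) ^ 2
      / ((k.factorial : ℝ) * ((k + 1).factorial : ℝ)) * betaIntegrand a x y k t)
    (fun k => (integrableOn_and_integral_betaIntegrand ha (σ := -c)
      (by linarith) (by linarith) k).1.const_mul _)
    (by simpa only [hnorm] using hsum.summable)
  simp only [integral_const_mul, ← hyperIntegrand_eq_tsum] at h
  have heq := h.unique hsum
  refine ⟨?_, heq⟩
  -- A non-integrable function would have integral $0$, contradicting $L_a>0$.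
  by_contra hni
  rw [integral_undef hni] at heq
  exact hpos.ne heq

theorem mainTheorem1 (a : ℝ) (ha : 0 < a) :
    -- `K_{ix}(b)` is real for real `x` and `b > 0`
    (∀ x b : ℝ, 0 < b → macdonaldK (I * x) b = (macdonaldKix x b : ℂ)) ∧
    -- the formula for `|K_{iz}(a)|^2`, its integral being convergent with nonnegative integrand
    (∀ x y : ℝ,
      IntegrableOn (hyperIntegrand a x y) (Ioo 0 1) ∧
      (∀ t ∈ Ioo (0 : ℝ) 1, 0 ≤ hyperIntegrand a x y t) ∧
      ‖macdonaldK (I * (x + y * I)) a‖ ^ 2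
        = macdonaldKix x a ^ 2 + y ^ 2 * ∫ t in Ioo (0 : ℝ) 1, hyperIntegrand a x y t) ∧
    -- the contour-integral form of `L_a(x,y)`, and its expansion in a series of positive integrals
    (∀ x y c : ℝ, c < -|y| →
      (∀ k : ℕ, Integrable (fun τ : ℝ => barnesIntegrand a x y k (c + τ * I))) ∧
      Summable (barnesTerm a x y c) ∧
      ((‖macdonaldK (I * (x + y * I)) a‖ ^ 2 : ℝ) : ℂ)
        = (macdonaldKix x a : ℂ) ^ 2 + (y : ℂ) ^ 2 * barnesL a x y c ∧
      (∀ k : ℕ, IntegrableOn (betaIntegrand a x y k) (Ioo 0 1) ∧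
        (∀ t ∈ Ioo (0 : ℝ) 1, 0 ≤ betaIntegrand a x y k t) ∧
        0 < ∫ t in Ioo (0 : ℝ) 1, betaIntegrand a x y k t) ∧
      (barnesL a x y c).im = 0 ∧
      0 < (barnesL a x y c).re ∧
      HasSum (fun k : ℕ =>
          ((ascPochhammer ℝ k).eval (y + 1)) ^ 2 / ((k.factorial : ℝ) * ((k + 1).factorial : ℝ))
            * ∫ t in Ioo (0 : ℝ) 1, betaIntegrand a x y k t)
        (barnesL a x y c).re) ∧
    -- `K_{iz}(a)` is an entire function of `z` with only real zeros
    Differentiable ℂ (fun z : ℂ => macdonaldK (I * z) a) ∧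
    (∀ z : ℂ, macdonaldK (I * z) a = 0 → z.im = 0) := by
  have hnorm : ∀ x y c : ℝ, c < -|y| → ((‖macdonaldK (I * (x + y * I)) a‖ ^ 2 : ℝ) : ℂ)
      = (macdonaldKix x a : ℂ) ^ 2 + (y : ℂ) ^ 2 * barnesL a x y c := fun x y c hc => by
    rw [norm_macdonaldK_sq, (summable_barnesTerm_and_mul_tsum ha hc).2]
    ring
  have hnormr : ∀ x y c : ℝ, c < -|y| → ‖macdonaldK (I * (x + y * I)) a‖ ^ 2
      = macdonaldKix x a ^ 2 + y ^ 2 * (barnesL a x y c).re := fun x y c hc => by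
    have h := congrArg re (hnorm x y c hc)
    rwa [ofReal_re, add_re, ← ofReal_pow, ← ofReal_pow, ofReal_re, re_ofReal_mul] at h
  refine ⟨fun x b _ => macdonaldK_I_mul_ofReal x b, fun x y => ?_, fun x y c hc => ?_, ?_, ?_⟩
  · have hc : -|y| - 1 < -|y| := by linarith
    obtain ⟨h1, h2⟩ := integrableOn_and_integral_hyperIntegrand (x := x) ha hc
    refine ⟨h1, fun t ht => hyperIntegrand_nonneg a x y ht, ?_⟩
    rw [h2]
    exact hnormr x y _ hc
  · have hy := neg_abs_le y
    have hy0 := abs_nonneg y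
    have hσ : 0 < -c := by linarith
    have hr : 0 < -c + y := by linarith
    refine ⟨fun k => ?_, (summable_barnesTerm_and_mul_tsum ha hc).1, hnorm x y c hc, fun k => ?_,
      barnesL_series ha hc⟩
    · refine (integrable_barnesIntegrand (x := x) ha hσ hr k).comp_neg.congr
        (Filter.Eventually.of_forall fun τ => ?_)
      simp only
      congr 1
      push_cast
      ring
    · have hi := (integrableOn_and_integral_betaIntegrand (x := x) ha hσ hr k).1
      exact ⟨hi, fun t ht => betaIntegrand_nonneg a x y k ht, integral_betaIntegrand_pos ha hi⟩
  · exact (differentiable_macdonaldK ha).comp (differentiable_id.const_mul I)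
  · intro z hz
    -- Off the real axis $|K_{iz}(a)|^2\ge y^2L_a(x,y)>0$.
    by_contra him
    have hc : -|z.im| - 1 < -|z.im| := by linarith
    have h := hnormr z.re z.im _ hc
    rw [re_add_im, hz, norm_zero] at h
    have hpos := (barnesL_series (x := z.re) ha hc).2.1
    have h1 : 0 < z.im ^ 2 * (barnesL a z.re z.im (-|z.im| - 1)).re := by positivity
    have h2 := sq_nonneg (macdonaldKix z.re a)
    linarith
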